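/- A pair of integers $(a,b)$ is a \emph{mutually cubic root pair} if $a^3\equiv 1 \pmod b$ and $b^3\equiv 1\pmod a$. Let $(a_t,b_t)_{t\in\mathbb N}$ be a sequence of mutually cubic root pairs such that the limits $$\tilde a=\lim_{t\to\infty}\frac{\log|a_t|}{\log|t|},\qquad \tilde b=\lim_{t\to\infty}\frac{\log|b_t|}{\log|t|}$$ exist in $\mathbb R$ and satisfy $0\le\tilde a\le\tilde b$. For an order $\mathcal O$ in a totally real cubic number field $K$ with real embeddings $\sigma_1,\sigma_2,\sigma_3$ (labelled in any order), the map $\psi(u)=(\log|\sigma_1(u)|,\log|\sigma_2(u)|,\log|\sigma_3(u)|)$ sends $\mathcal O^\times$ onto a lattice in the Euclidean plane $\mathbb R^3_0=\{x\in\mathbb R^3: x_1+x_2+x_3=0\}$. A shape of the unit lattice is a point of the modular curve $\operatorname{SL}_2(\mathbb Z)\backslash\mathbb H$ represented by some $z\in\mathbb H$ for which a similarity $\mathbb R^3_0\to\mathbb C$ (an $\mathbb R$-linear isomorphism multiplying all lengths by a positive constant) maps $\psi(\mathcal O^\times)$ onto $\mathbb Z+\mathbb Z z$. Let $\Omega\subseteq\operatorname{SL}_2(\mathbb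 Z)\backslash\mathbb H$ be the set of all shapes of unit lattices of orders in totally real cubic number fields, and let $\overline\Omega$ be its closure in the quotient topology. Then, with $\omega=e^{2\pi i/3}$, for every real $r$ with $0\le r\le\min\left(\frac1{3\tilde a},\frac1{\tilde b}\right)$ (where $\frac10=\infty$, so that $r$ ranges over $[0,\infty)$ if $\tilde a=\tilde b=0$) the number $$\gamma(r)=\frac{1+2r\tilde a+(1+r\tilde b+2r\tilde a)\,\omega}{1+r\tilde a+(r\tilde a-r\tilde b)\,\omega}$$ lies in $\mathbb H$, and its image in $\operatorname{SL}_2(\mathbb Z)\backslash\mathbb H$ belongs to $\overline\Omega$. -/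

import Mathlib

open Filter Topology
open scoped UpperHalfPlane MatrixGroups

/-- A pair of integers `(a, b)` is a *mutually cubic root pair* if `a ^ 3 ≡ 1` modulo `b`
and `b ^ 3 ≡ 1` modulo `a`. -/
def IsMutuallyCubicRootPair (a b : ℤ) : Prop :=
  a ^ 3 ≡ 1 [ZMOD b] ∧ b ^ 3 ≡ 1 [ZMOD a]

/-- The sequence `(a t, b t)` is a *mutually cubic root sequence* if each of its members is a
mutually cubic root pair. -/
def IsMutuallyCubicRootSequence (a b : ℕ → ℤ) : Prop :=
  ∀ t, IsMutuallyCubicRootPair (a t) (b t)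

/-- The modular curve `SL₂(ℤ) \ ℍ`; it carries the quotient topology. -/
abbrev ModularCurve : Type := MulAction.orbitRel.Quotient SL(2, ℤ) ℍ

/-- The projection `ℍ → SL₂(ℤ) \ ℍ`. -/
noncomputable def ModularCurve.mk (z : ℍ) : ModularCurve := Quotient.mk (MulAction.orbitRel SL(2, ℤ) ℍ) z

/-- A subring `O` of a number field `K` of degree `n` is an *order* if its additive group is a
full module: the `ℤ`-span of `n` elements, with `ℚ O = K`. -/
def IsOrder {K : Type} [Field K] [NumberField K] (O : Subring K) : Prop :=
  (∃ α : Fin (Module.finrank ℚ K) → K,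
    (O : Set K) = (Submodule.span ℤ (Set.range α) : Set K)) ∧
  Submodule.span ℚ (O : Set K) = ⊤

/-- The plane `ℝ³₀ = {x ∈ ℝ³ : x₁ + x₂ + x₃ = 0}`, with the Euclidean metric of `ℝ³`. -/
def sumZeroPlane : Submodule ℝ (EuclideanSpace ℝ (Fin 3)) where
  carrier := {x | ∑ i, x i = 0}
  add_mem' := by
    intro x y hx hy
    simp only [Set.mem_ofPred_eq, PiLp.add_apply, Finset.sum_add_distrib] at *
    rw [hx, hy, add_zero]
  zero_mem' := by simp
  smul_mem' := by
    intro c x hx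
    simp only [Set.mem_ofPred_eq, PiLp.smul_apply, smul_eq_mul, ← Finset.mul_sum] at *
    rw [hx, mul_zero]

/-- The logarithmic map `ψ(α) = (log |σ₁ α|, log |σ₂ α|, log |σ₃ α|)` of a field with a list
`σ` of three real embeddings. -/
noncomputable def logMap {K : Type} [Field K] (σ : Fin 3 → (K →+* ℝ)) (x : K) :
    EuclideanSpace ℝ (Fin 3) :=
  WithLp.toLp 2 fun i => Real.log |σ i x|

/-- The unit lattice `ψ(Oˣ)`, as a subset of the plane `ℝ³₀`. (Units of orders have norm `±1`,
so all of `ψ(Oˣ)` lies in this plane.) -/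
def unitLattice {K : Type} [Field K] (σ : Fin 3 → (K →+* ℝ)) (O : Subring K) :
    Set sumZeroPlane :=
  {x | ∃ u : Oˣ, (x : EuclideanSpace ℝ (Fin 3)) = logMap σ ((u : O) : K)}

/-- A linear isomorphism from the plane `ℝ³₀` to `ℂ` is a *similarity* if it multiplies all
lengths by one positive constant. -/
def IsSimilarity (f : sumZeroPlane ≃ₗ[ℝ] ℂ) : Prop :=
  ∃ c : ℝ, 0 < c ∧ ∀ x, ‖f x‖ = c * ‖x‖

/-- The point `p` of `SL₂(ℤ) \ ℍ` is a *shape* of the set `Λ ⊆ ℝ³₀` if `p` is the class of some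
`z ∈ ℍ` for which a similarity maps `Λ` onto the lattice `ℤ + ℤ z`. -/
def IsShapeOf (Λ : Set sumZeroPlane) (p : ModularCurve) : Prop :=
  ∃ (z : ℍ) (f : sumZeroPlane ≃ₗ[ℝ] ℂ), ModularCurve.mk z = p ∧ IsSimilarity f ∧
    f '' Λ = {w : ℂ | ∃ m n : ℤ, w = m + n * (z : ℂ)}

/-- The set `Ω ⊆ SL₂(ℤ) \ ℍ` of all shapes of unit lattices of orders in totally real cubic
number fields; `σ` is a labelling of the three real embeddings of the field. -/
def unitShapes : Set ModularCurve :=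
  {p | ∃ (K : Type) (_ : Field K) (_ : NumberField K) (O : Subring K) (σ : Fin 3 ≃ (K →+* ℝ)),
    NumberField.IsTotallyReal K ∧ Module.finrank ℚ K = 3 ∧ IsOrder O ∧
      IsShapeOf (unitLattice σ O) p}

/-- The primitive cube root of unity `ω = exp (2πi/3)`. -/
noncomputable def omega : ℂ := Complex.exp (2 * Real.pi * Complex.I / 3)

/-- The curve
`γ(r) = (1 + 2rα + (1 + rβ + 2rα) ω) / (1 + rα + (rα - rβ) ω)`. -/
noncomputable def shapeCurve (α β r : ℝ) : ℂ :=
  (1 + 2 * r * α + (1 + r * β + 2 * r * α) * omega) / (1 + r * α + (r * α - r * β) * omega)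

/-- The interval `[0, min (1/(3α), 1/β)]` for `α, β ≥ 0`, where `1/0 = ∞`; it is `[0, ∞)` if
`α = β = 0`. -/
def curveDomain (α β : ℝ) : Set ℝ := {r | 0 ≤ r ∧ 3 * α * r ≤ 1 ∧ β * r ≤ 1}

-- Triangles, covering discs and generators of plane lattices

section Covering

variable {E : Type*} [NormedAddCommGroup E] [InnerProductSpace ℝ E]

-- For a mutually cubic root pair with `a`, `b` nonzero, the congruences make `ab` divide `1 - a³ -
-- b³`. Hence there is a one-parameter family of cubics `f = x³ + p x² + q x + 1` with `a³ f(b/a) =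
-- 1`. For a root `θ`, both `θ` and `aθ - b` are then units of `ℤ[θ]`. Moving along the family gives
-- `p ≈ aK` and `q ≈ -bK` for any large `K`, and the roots are then about `1/(bK)`, `b/a` and `-aK`
-- (`exists_roots_of_approx`). With `A`, `B`, `k` the logarithms of `|a|`, `|b|`, `K`, the log
-- vectors of the two units are, up to bounded error, `U = (-(B+k), B-A, A+k)` and `V = (B,
-- -(B+2A+k), 2A+k)`.
--
-- The difficulty is that these units generate the whole unit lattice, not a sublattice. The
-- discriminant decides this: a unit `g ≠ ±1` of `ℤ[θ]` generates a suborder, so the differences of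
-- its conjugates have a product at least that of `θ`, about `|ab|K²`. This bounds the log vector of
-- `g` from below: `‖w‖² ≥ l²/2` with `l` about `A + B + 2k` (`RealCubic.sq_le_norm_sq`). On the
-- other hand, if the squared edges of the triangle `0, U, ±V` are less than three times this bound,
-- every point of the triangle is closer to a vertex than the shortest lattice vector is long. No
-- further lattice point fits, and `U, V` are generators (`AddSubgroup.exists_eq_zsmul_add_zsmul`).
-- The bounds on `r` are what the resulting inequalities (`shape_inequalities`) and the growth of
-- `K` require.
--
-- Finally take `K = t^(1/r)`. Then `A/k → rα` and `B/k → rβ`, the bounded errors vanish after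
-- division by `k`, and the shapes converge to `γ(r)`. Endpoints of the interval follow by
-- continuity of `γ`.

theorem norm_smul_add_smul_sq (u v : E) (c d : ℝ) :
    ‖c • u + d • v‖ ^ 2 = c ^ 2 * ‖u‖ ^ 2 + 2 * c * d * inner ℝ u v + d ^ 2 * ‖v‖ ^ 2 := by
  rw [norm_add_sq_real, norm_smul, norm_smul, real_inner_smul_left, real_inner_smul_right,
    mul_pow, mul_pow, Real.norm_eq_abs, Real.norm_eq_abs, sq_abs, sq_abs]
  ring

/-- If the squared edges of the triangle `0, u, v` are at most `3 M`, each of its points has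
squared distance at most `M` from some vertex. -/
theorem norm_sq_le_of_mem_triangle {u v : E} {M s t : ℝ} (hu : ‖u‖ ^ 2 ≤ 3 * M)
    (hv : ‖v‖ ^ 2 ≤ 3 * M) (huv : ‖u - v‖ ^ 2 ≤ 3 * M) (hs : 0 ≤ s) (ht : 0 ≤ t)
    (hst : s + t ≤ 1) :
    ‖s • u + t • v‖ ^ 2 ≤ M ∨ ‖s • u + t • v - u‖ ^ 2 ≤ M ∨ ‖s • u + t • v - v‖ ^ 2 ≤ M := by
  by_contra! h
  obtain ⟨h0, h1, h2⟩ := h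
  have e1 : s • u + t • v - u = (s - 1) • u + t • v := by module
  have e2 : s • u + t • v - v = s • u + (t - 1) • v := by module
  have e3 : u - v = (1 : ℝ) • u + (-1 : ℝ) • v := by module
  rw [norm_smul_add_smul_sq] at h0
  rw [e1, norm_smul_add_smul_sq] at h1
  rw [e2, norm_smul_add_smul_sq] at h2
  rw [e3, norm_smul_add_smul_sq] at huv
  set N := ‖u‖ ^ 2
  set P := ‖v‖ ^ 2
  set I : ℝ := inner ℝ u v
  have hM : 0 ≤ M := by have : 0 ≤ N := sq_nonneg _; linarith
  have a1 := mul_le_mul_of_nonneg_left hu (mul_nonneg hs (sub_nonneg.2 hst))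
  have a2 := mul_le_mul_of_nonneg_left hv (mul_nonneg ht (sub_nonneg.2 hst))
  have a3 := mul_le_mul_of_nonneg_left huv (mul_nonneg hs ht)
  have b0 := mul_le_mul_of_nonneg_left h0.le (sub_nonneg.2 hst)
  have b1 := mul_le_mul_of_nonneg_left h1.le hs
  have b2 := mul_le_mul_of_nonneg_left h2.le ht
  -- Barycentric weights have pairwise products of sum at most 1/3. The weighted mean of the squared
  -- distances to the vertices is the sum of these products times the squared edges, so it is at
  -- most `M`.
  have hq : 0 ≤ M * ((s - t) ^ 2 + (s - (1 - (s + t))) ^ 2 + (t - (1 - (s + t))) ^ 2) := by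
    positivity
  have key : (1 - (s + t)) * (s ^ 2 * N + 2 * s * t * I + t ^ 2 * P - M)
      + s * ((s - 1) ^ 2 * N + 2 * (s - 1) * t * I + t ^ 2 * P - M)
      + t * (s ^ 2 * N + 2 * s * (t - 1) * I + (t - 1) ^ 2 * P - M) ≤ 0 := by
    nlinarith
  rcases hs.lt_or_eq with hs' | hs'
  · nlinarith [mul_pos hs' (sub_pos.2 h1)]
  rcases ht.lt_or_eq with ht' | ht'
  · nlinarith [mul_pos ht' (sub_pos.2 h2)]
  · subst hs' ht'
    nlinarith

/-- A lattice point in the triangle `0, u, v` is so close to a vertex that their difference, being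
in `Λ` and shorter than every nonzero vector of `Λ`, vanishes. Translation and a point reflection
carry the rest of the plane to this triangle. -/
theorem AddSubgroup.exists_eq_zsmul_add_zsmul (Λ : AddSubgroup E) {u v : E} (hu : u ∈ Λ)
    (hv : v ∈ Λ) {m M : ℝ} (hmin : ∀ w ∈ Λ, w ≠ 0 → m ≤ ‖w‖ ^ 2) (hM : M < m)
    (hnu : ‖u‖ ^ 2 ≤ 3 * M) (hnv : ‖v‖ ^ 2 ≤ 3 * M)
    (huv : ‖u - v‖ ^ 2 ≤ 3 * M ∨ ‖u + v‖ ^ 2 ≤ 3 * M) {s t : ℝ} (hx : s • u + t • v ∈ Λ) :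
    ∃ i j : ℤ, s • u + t • v = i • u + j • v := by
  wlog h : ‖u - v‖ ^ 2 ≤ 3 * M generalizing v t
  · have h' : ‖u - -v‖ ^ 2 ≤ 3 * M := by rw [sub_neg_eq_add]; exact huv.resolve_left h
    obtain ⟨i, j, hij⟩ := this (v := -v) (t := -t) (neg_mem hv) (by rwa [norm_neg]) (.inl h')
      (by simpa using hx) h'
    exact ⟨i, -j, by simpa using hij⟩
  have tri : ∀ {s t : ℝ}, 0 ≤ s → 0 ≤ t → s + t ≤ 1 → s • u + t • v ∈ Λ →
      ∃ i j : ℤ, s • u + t • v = i • u + j • v := by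
    intro s t hs ht hst hx
    have key : ∀ w ∈ Λ, ‖w‖ ^ 2 ≤ M → w = 0 := fun w hw hle => by
      by_contra h0
      linarith [hmin w hw h0]
    rcases norm_sq_le_of_mem_triangle hnu hnv h hs ht hst with h | h | h
    · exact ⟨0, 0, by simpa using key _ hx h⟩
    · exact ⟨1, 0, by simpa using sub_eq_zero.1 (key _ (sub_mem hx hu) h)⟩
    · exact ⟨0, 1, by simpa using sub_eq_zero.1 (key _ (sub_mem hx hv) h)⟩
  have e : s • u + t • v
      = (Int.fract s • u + Int.fract t • v) + (⌊s⌋ • u + ⌊t⌋ • v) := by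
    simp only [Int.fract, ← Int.cast_smul_eq_zsmul ℝ]
    module
  have hfl : ⌊s⌋ • u + ⌊t⌋ • v ∈ Λ := add_mem (zsmul_mem hu _) (zsmul_mem hv _)
  have hfr : Int.fract s • u + Int.fract t • v ∈ Λ := by
    have := sub_mem hx hfl
    rwa [e, add_sub_cancel_right] at this
  suffices ∃ i j : ℤ, Int.fract s • u + Int.fract t • v = i • u + j • v by
    obtain ⟨i, j, hij⟩ := this
    exact ⟨i + ⌊s⌋, j + ⌊t⌋, by rw [e, hij]; module⟩
  rcases le_total (Int.fract s + Int.fract t) 1 with h1 | h1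
  · exact tri (Int.fract_nonneg s) (Int.fract_nonneg t) h1 hfr
  -- The other half of the fundamental parallelogram is the image of the triangle under `x ↦ u + v -
  -- x`.
  · have e' : (1 - Int.fract s) • u + (1 - Int.fract t) • v
        = (u + v) - (Int.fract s • u + Int.fract t • v) := by module
    obtain ⟨i, j, hij⟩ := tri (s := 1 - Int.fract s) (t := 1 - Int.fract t)
      (by linarith [Int.fract_lt_one s]) (by linarith [Int.fract_lt_one t]) (by linarith)
      (by rw [e']; exact sub_mem (add_mem hu hv) hfr)
    refine ⟨1 - i, 1 - j, ?_⟩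
    rw [e', sub_eq_iff_eq_add] at hij
    rw [← sub_eq_iff_eq_add'.2 hij]
    module

end Covering

-- Discriminant bounds and cubics with three real roots

theorem abs_sub_le_two_mul_exp_max {x y : ℝ} (hx : x ≠ 0) (hy : y ≠ 0) :
    |x - y| ≤ 2 * Real.exp (max (Real.log |x|) (Real.log |y|)) := by
  have h1 : |x| ≤ Real.exp (max (Real.log |x|) (Real.log |y|)) := by
    rw [← Real.log_le_iff_le_exp (abs_pos.2 hx)]; exact le_max_left _ _
  have h2 : |y| ≤ Real.exp (max (Real.log |x|) (Real.log |y|)) := by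
    rw [← Real.log_le_iff_le_exp (abs_pos.2 hy)]; exact le_max_right _ _
  linarith [abs_sub x y]

/-- A lower bound for the differences of three numbers with product `±1` bounds the vector of
their logarithms from below. -/
theorem sq_le_two_mul_sum_log_sq {x y w l : ℝ} (h : |x * y * w| = 1) (hl : 0 ≤ l)
    (hd : 8 * Real.exp l ≤ |(x - y) * (x - w) * (y - w)|) :
    l ^ 2 ≤ 2 * (Real.log |x| ^ 2 + Real.log |y| ^ 2 + Real.log |w| ^ 2) := by
  have hne : x * y * w ≠ 0 := by rw [← abs_pos, h]; exact one_pos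
  have hx : x ≠ 0 := by rintro rfl; simp at hne
  have hy : y ≠ 0 := by rintro rfl; simp at hne
  have hw : w ≠ 0 := by rintro rfl; simp at hne
  have hsum : Real.log |x| + Real.log |y| + Real.log |w| = 0 := by
    rw [← Real.log_mul, ← Real.log_mul, ← abs_mul, ← abs_mul, h, Real.log_one] <;>
      simp [hx, hy, hw]
  have e1 := abs_sub_le_two_mul_exp_max hx hy
  have e2 := abs_sub_le_two_mul_exp_max hx hw
  have e3 := abs_sub_le_two_mul_exp_max hy hw
  generalize Real.log |x| = X at *
  generalize Real.log |y| = Y at *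
  generalize Real.log |w| = W at *
  have h8 : 8 * Real.exp l ≤ 8 * Real.exp (max X Y + max X W + max Y W) := by
    calc 8 * Real.exp l ≤ |(x - y) * (x - w) * (y - w)| := hd
      _ = |x - y| * |x - w| * |y - w| := by rw [abs_mul, abs_mul]
      _ ≤ (2 * Real.exp (max X Y)) * (2 * Real.exp (max X W)) * (2 * Real.exp (max Y W)) := by
        gcongr
      _ = 8 * Real.exp (max X Y + max X W + max Y W) := by
        rw [Real.exp_add, Real.exp_add]; ring
  have hle : l ≤ max X Y + max X W + max Y W := by
    rw [← Real.exp_le_exp]; linarith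
  have hsq : l ^ 2 ≤ (max X Y + max X W + max Y W) ^ 2 := pow_le_pow_left₀ hl hle 2
  refine hsq.trans ?_
  -- For logarithms of sum zero, the sum of the three maxima is the largest minus the smallest,
  -- whose square is at most twice the sum of squares.
  have hW : W = -X - Y := by linarith
  subst hW
  rcases le_total X Y with h1 | h1 <;> rcases le_total X (-X - Y) with h2 | h2 <;>
    rcases le_total Y (-X - Y) with h3 | h3 <;> simp only [h1, h2, h3, max_eq_left, max_eq_right]
    <;> nlinarith [sq_nonneg X, sq_nonneg Y, sq_nonneg (X + Y), sq_nonneg (X - Y),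
      sq_nonneg (2 * X + Y), sq_nonneg (X + 2 * Y)]

/-- The data of a cubic polynomial `x³ + p x² + q x + 1` with integral coefficients, without
rational roots, and its three real roots. -/
structure RealCubic (p q : ℤ) (θ : Fin 3 → ℝ) : Prop where
  injective : Function.Injective θ
  sum_eq : θ 0 + θ 1 + θ 2 = -p
  sum_mul_eq : θ 0 * θ 1 + θ 0 * θ 2 + θ 1 * θ 2 = q
  prod_eq : θ 0 * θ 1 * θ 2 = -1
  not_root : ∀ n : ℤ, n ^ 3 + p * n ^ 2 + q * n + 1 ≠ 0

namespace RealCubic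

variable {p q : ℤ} {θ : Fin 3 → ℝ}

theorem eval_eq (h : RealCubic p q θ) (x : ℝ) :
    x ^ 3 + p * x ^ 2 + q * x + 1 = (x - θ 0) * (x - θ 1) * (x - θ 2) := by
  linear_combination x ^ 2 * h.sum_eq - x * h.sum_mul_eq + h.prod_eq

theorem root (h : RealCubic p q θ) (i : Fin 3) : θ i ^ 3 + p * θ i ^ 2 + q * θ i + 1 = 0 := by
  rw [h.eval_eq]
  fin_cases i <;> simp

theorem rat_not_root (h : RealCubic p q θ) (x : ℚ) : x ^ 3 + p * x ^ 2 + q * x + 1 ≠ 0 := by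
  intro hx
  have hint : IsIntegral ℤ x := by
    refine ⟨Polynomial.X ^ 3 + Polynomial.C p * Polynomial.X ^ 2
      + Polynomial.C q * Polynomial.X + 1, by monicity!, ?_⟩
    rw [← Polynomial.aeval_def]
    simpa using hx
  obtain ⟨n, rfl⟩ := IsIntegrallyClosed.isIntegral_iff.1 hint
  refine h.not_root n ?_
  have : (n : ℚ) ^ 3 + p * n ^ 2 + q * n + 1 = 0 := by simpa using hx
  exact_mod_cast this

/-- The quotient of the two products is the index form of `ℤ[θ]`, an integer. It equals `z³ f((y -
zp)/z)` for `z ≠ 0` and `y³` for `z = 0`, so it is nonzero because `f` has no rational root. -/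
theorem abs_discr_le (h : RealCubic p q θ) {x y z : ℤ} (hyz : y ≠ 0 ∨ z ≠ 0) {g : Fin 3 → ℝ}
    (hg : ∀ i, g i = x + y * θ i + z * θ i ^ 2) :
    |(θ 0 - θ 1) * (θ 0 - θ 2) * (θ 1 - θ 2)| ≤ |(g 0 - g 1) * (g 0 - g 2) * (g 1 - g 2)| := by
  set N : ℤ := (y - z * p) ^ 3 + (y - z * p) ^ 2 * z * p + (y - z * p) * z ^ 2 * q + z ^ 3 with hN
  have hN0 : N ≠ 0 := by
    intro h0
    by_cases hz : z = 0
    · subst hz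
      have : y ^ 3 = 0 := by simpa [h0] using hN.symm
      simp_all
    · have hz' : (z : ℚ) ≠ 0 := by exact_mod_cast hz
      apply h.rat_not_root (((y - z * p : ℤ) : ℚ) / z)
      have : (N : ℚ) = 0 := by rw [h0]; simp
      rw [hN] at this
      push_cast at this ⊢
      field_simp
      linear_combination this
  have e : (g 0 - g 1) * (g 0 - g 2) * (g 1 - g 2)
      = (θ 0 - θ 1) * (θ 0 - θ 2) * (θ 1 - θ 2) * (N : ℝ) := by
    have hp : (p : ℝ) = -(θ 0 + θ 1 + θ 2) := by linarith [h.sum_eq]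
    have hone : θ 0 * θ 1 * θ 2 = -1 := h.prod_eq
    rw [hg, hg, hg, hN]
    push_cast
    rw [hp, ← h.sum_mul_eq]
    linear_combination (-(θ 0 - θ 1) * (θ 0 - θ 2) * (θ 1 - θ 2) * z ^ 3) * hone
  rw [e, abs_mul _ (N : ℝ)]
  refine le_mul_of_one_le_right (abs_nonneg _) ?_
  exact_mod_cast Int.one_le_abs hN0

theorem exists_int_eq_prod (h : RealCubic p q θ) {x y z : ℤ} {g : Fin 3 → ℝ}
    (hg : ∀ i, g i = x + y * θ i + z * θ i ^ 2) : ∃ n : ℤ, g 0 * g 1 * g 2 = n := by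
  refine ⟨x ^ 3 - x ^ 2 * y * p + x ^ 2 * z * (p ^ 2 - 2 * q) + x * y ^ 2 * q
    + x * y * z * (-p * q + 3) + x * z ^ 2 * (q ^ 2 - 2 * p) - y ^ 3 + y ^ 2 * z * p
    - y * z ^ 2 * q + z ^ 3, ?_⟩
  have hp : (p : ℝ) = -(θ 0 + θ 1 + θ 2) := by linarith [h.sum_eq]
  have hone := h.prod_eq
  rw [hg, hg, hg]
  push_cast
  rw [hp, ← h.sum_mul_eq]
  generalize θ 0 = r at *
  generalize θ 1 = s at *
  generalize θ 2 = t at *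
  linear_combination (-3 * x * y * z - 2 * x * z ^ 2 * (r + s + t) + y ^ 3
    + y ^ 2 * z * (r + s + t) + y * z ^ 2 * (r * s + r * t + s * t)
    - (1 - r * s * t) * z ^ 3) * hone

end RealCubic

-- The cubic field and the order generated by a root

section Field

open Polynomial

/-- The polynomial `X³ + p X² + q X + 1` over a commutative ring. -/
noncomputable def unitCubic (R : Type) [CommRing R] (p q : ℤ) : R[X] :=
  X ^ 3 + (p : R[X]) * X ^ 2 + (q : R[X]) * X + 1

theorem unitCubic_eq (R : Type) [CommRing R] (p q : ℤ) :
    unitCubic R p q = X ^ 3 + C (p : R) * X ^ 2 + C (q : R) * X + 1 := by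
  simp [unitCubic]

theorem eval₂_unitCubic {R S : Type} [CommRing R] [CommRing S] (f : R →+* S) (x : S) (p q : ℤ) :
    (unitCubic R p q).eval₂ f x = x ^ 3 + p * x ^ 2 + q * x + 1 := by
  rw [unitCubic_eq]
  simp only [eval₂_add, eval₂_mul, eval₂_pow, eval₂_X, eval₂_C, eval₂_one]
  rw [map_intCast, map_intCast]

theorem unitCubic_monic (R : Type) [CommRing R] [Nontrivial R] (p q : ℤ) :
    (unitCubic R p q).Monic := by
  rw [unitCubic_eq]; monicity!

theorem unitCubic_natDegree (R : Type) [CommRing R] [Nontrivial R] (p q : ℤ) :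
    (unitCubic R p q).natDegree = 3 := by
  rw [unitCubic_eq]; compute_degree!

namespace RealCubic

variable {p q : ℤ} {θ : Fin 3 → ℝ}

theorem irreducible (h : RealCubic p q θ) : Irreducible (unitCubic ℚ p q) := by
  refine irreducible_of_degree_le_three_of_not_isRoot (by simp [unitCubic_natDegree]) fun x hx => ?_
  apply h.rat_not_root x
  simpa [unitCubic, IsRoot] using hx

end RealCubic

variable (p q : ℤ)

/-- The number field generated by a root of `x³ + p x² + q x + 1`. -/
abbrev CubicField : Type := AdjoinRoot (unitCubic ℚ p q)

/-- The order `ℤ[θ]` generated by a root `θ` of `x³ + p x² + q x + 1`. -/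
noncomputable def cubicOrder : Subring (CubicField p q) :=
  (Algebra.adjoin ℤ {AdjoinRoot.root (unitCubic ℚ p q)}).toSubring

variable {p q}

theorem CubicField.root_eq : AdjoinRoot.root (unitCubic ℚ p q) ^ 3
    + p * AdjoinRoot.root (unitCubic ℚ p q) ^ 2 + q * AdjoinRoot.root (unitCubic ℚ p q) + 1
      = 0 := by
  rw [← eval₂_unitCubic (AdjoinRoot.of (unitCubic ℚ p q)), AdjoinRoot.eval₂_root]

theorem root_mem_cubicOrder : AdjoinRoot.root (unitCubic ℚ p q) ∈ cubicOrder p q :=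
  Algebra.subset_adjoin rfl

theorem cubicOrder_eq_span : (cubicOrder p q : Set (CubicField p q)) = (Submodule.span ℤ
    (Set.range fun i : Fin 3 => AdjoinRoot.root (unitCubic ℚ p q) ^ (i : ℕ)) :
      Set (CubicField p q)) := by
  have h := Submodule.span_range_natDegree_eq_adjoin (unitCubic_monic ℤ p q)
    (x := AdjoinRoot.root (unitCubic ℚ p q)) 
    (by rw [aeval_def, eval₂_unitCubic, CubicField.root_eq])
  have hs : (Finset.image (AdjoinRoot.root (unitCubic ℚ p q) ^ ·)
      (Finset.range (unitCubic ℤ p q).natDegree) : Set (CubicField p q))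
      = Set.range fun i : Fin 3 => AdjoinRoot.root (unitCubic ℚ p q) ^ (i : ℕ) := by
    rw [unitCubic_natDegree]
    ext x
    simp [Fin.exists_iff]
  rw [hs] at h
  rw [h]
  rfl

theorem mem_cubicOrder {x : CubicField p q} (hx : x ∈ cubicOrder p q) :
    ∃ c d e : ℤ, x = c + d * AdjoinRoot.root (unitCubic ℚ p q)
      + e * AdjoinRoot.root (unitCubic ℚ p q) ^ 2 := by
  rw [← SetLike.mem_coe, cubicOrder_eq_span, SetLike.mem_coe,
    Submodule.mem_span_range_iff_exists_fun] at hx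
  obtain ⟨c, rfl⟩ := hx
  exact ⟨c 0, c 1, c 2, by simp [Fin.sum_univ_three]⟩

namespace RealCubic

variable {θ : Fin 3 → ℝ}

/-- The embedding of the cubic field that sends the generator to the root `θ i`. -/
noncomputable def embedding (h : RealCubic p q θ) (i : Fin 3) : CubicField p q →+* ℝ :=
  AdjoinRoot.lift (algebraMap ℚ ℝ) (θ i) (by rw [eval₂_unitCubic, h.root])

@[simp]
theorem embedding_root (h : RealCubic p q θ) (i : Fin 3) :
    h.embedding i (AdjoinRoot.root _) = θ i :=
  AdjoinRoot.lift_root _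

/-- Used twice: it makes the field totally real, and it shows that the three listed real embeddings
are all of them. -/
theorem eq_embedding (h : RealCubic p q θ) (φ : CubicField p q →+* ℂ) :
    ∃ i, φ = Complex.ofRealHom.comp (h.embedding i) := by
  have hr := congrArg φ CubicField.root_eq
  simp only [map_add, map_mul, map_pow, map_intCast, map_one, map_zero] at hr
  have hz : (φ (AdjoinRoot.root _) - θ 0) * (φ (AdjoinRoot.root _) - θ 1)
      * (φ (AdjoinRoot.root _) - θ 2) = 0 := by
    have h1 := congrArg (Complex.ofReal) h.sum_eq
    have h2 := congrArg (Complex.ofReal) h.sum_mul_eq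
    have h3 := congrArg (Complex.ofReal) h.prod_eq
    push_cast at h1 h2 h3
    linear_combination hr - (φ (AdjoinRoot.root _)) ^ 2 * h1 + (φ (AdjoinRoot.root _)) * h2 - h3
  have hi : ∃ i, φ (AdjoinRoot.root _) = θ i := by
    rcases mul_eq_zero.1 hz with hz | hz
    · rcases mul_eq_zero.1 hz with hz | hz
      · exact ⟨0, sub_eq_zero.1 hz⟩
      · exact ⟨1, sub_eq_zero.1 hz⟩
    · exact ⟨2, sub_eq_zero.1 hz⟩
  obtain ⟨i, hi⟩ := hi
  refine ⟨i, AdjoinRoot.ringHom_ext ?_ ?_⟩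
  · exact RingHom.ext_rat _ _
  · simp [hi]

/-- The three real embeddings of the cubic field. -/
noncomputable def embeddingEquiv (h : RealCubic p q θ) : Fin 3 ≃ (CubicField p q →+* ℝ) :=
  Equiv.ofBijective h.embedding <| by
    refine ⟨fun i j hij => h.injective ?_, fun φ => ?_⟩
    · rw [← h.embedding_root i, hij, h.embedding_root]
    · obtain ⟨i, hi⟩ := h.eq_embedding (Complex.ofRealHom.comp φ)
      refine ⟨i, RingHom.ext fun x => ?_⟩
      have := RingHom.congr_fun hi x
      simpa using this.symm

variable [Fact (Irreducible (unitCubic ℚ p q))]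

instance : NumberField (CubicField p q) where
  to_charZero := inferInstance
  to_finiteDimensional := (unitCubic_monic ℚ p q).finite_adjoinRoot

theorem isTotallyReal (h : RealCubic p q θ) : NumberField.IsTotallyReal (CubicField p q) := by
  refine ⟨fun v => ?_⟩
  rw [NumberField.InfinitePlace.isReal_iff, NumberField.ComplexEmbedding.isReal_iff]
  obtain ⟨i, hi⟩ := h.eq_embedding v.embedding
  rw [hi]
  exact RingHom.ext fun x => by simp [NumberField.ComplexEmbedding.conjugate_coe_eq]

theorem finrank_eq : Module.finrank ℚ (CubicField p q) = 3 := by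
  rw [(AdjoinRoot.powerBasis (unitCubic_monic ℚ p q).ne_zero).finrank,
    AdjoinRoot.powerBasis_dim, unitCubic_natDegree]

theorem isOrder : IsOrder (cubicOrder p q) := by
  have h3 := finrank_eq (p := p) (q := q)
  refine ⟨⟨fun i => AdjoinRoot.root (unitCubic ℚ p q) ^ (i : ℕ), ?_⟩, ?_⟩
  · rw [cubicOrder_eq_span, h3]
  · rw [eq_top_iff, ← (AdjoinRoot.powerBasis (unitCubic_monic ℚ p q).ne_zero).basis.span_eq]
    refine Submodule.span_mono ?_
    rintro _ ⟨i, rfl⟩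
    rw [PowerBasis.basis_eq_pow]
    exact pow_mem root_mem_cubicOrder _

end RealCubic

end Field

-- The sum-zero plane as the complex plane, and shapes from generators

theorem omega_re : omega.re = -1 / 2 := by
  have h : (2 * Real.pi * Complex.I / 3 : ℂ) = ((2 * Real.pi / 3 : ℝ) : ℂ) * Complex.I := by
    push_cast; ring
  rw [omega, h, Complex.exp_ofReal_mul_I_re,
    show (2 * Real.pi / 3 : ℝ) = Real.pi - Real.pi / 3 by ring, Real.cos_pi_sub,
    Real.cos_pi_div_three]
  norm_num

theorem omega_im : omega.im = √3 / 2 := by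
  have h : (2 * Real.pi * Complex.I / 3 : ℂ) = ((2 * Real.pi / 3 : ℝ) : ℂ) * Complex.I := by
    push_cast; ring
  rw [omega, h, Complex.exp_ofReal_mul_I_im,
    show (2 * Real.pi / 3 : ℝ) = Real.pi - Real.pi / 3 by ring, Real.sin_pi_sub,
    Real.sin_pi_div_three]

/-- The map `x ↦ x₃ - x₂ ω`, a similarity on the plane `ℝ³₀`. -/
noncomputable def hexMap : EuclideanSpace ℝ (Fin 3) →ₗ[ℝ] ℂ where
  toFun x := x 2 - x 1 * omega
  map_add' x y := by simp; ring
  map_smul' c x := by simp; ring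

theorem hexMap_apply (x : EuclideanSpace ℝ (Fin 3)) : hexMap x = x 2 - x 1 * omega := rfl

theorem hexMap_re (x : EuclideanSpace ℝ (Fin 3)) : (hexMap x).re = x 2 + x 1 / 2 := by
  simp [hexMap_apply, omega_re]; ring

theorem hexMap_im (x : EuclideanSpace ℝ (Fin 3)) : (hexMap x).im = -(x 1 * (√3 / 2)) := by
  simp [hexMap_apply, omega_im]

theorem sum_eq_zero_of_mem_sumZeroPlane {x : EuclideanSpace ℝ (Fin 3)} (hx : x ∈ sumZeroPlane) :
    x 0 + x 1 + x 2 = 0 := by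
  rw [← Fin.sum_univ_three (fun i => x i)]; exact hx

theorem norm_hexMap_sq {x : EuclideanSpace ℝ (Fin 3)} (hx : x ∈ sumZeroPlane) :
    ‖hexMap x‖ ^ 2 = ‖x‖ ^ 2 / 2 := by
  have h3 : (√3) ^ 2 = 3 := Real.sq_sqrt (by norm_num)
  have h0 : x 0 = -x 1 - x 2 := by linarith [sum_eq_zero_of_mem_sumZeroPlane hx]
  -- Both sides are the form `x₂² + x₂x₃ + x₃²`.
  rw [EuclideanSpace.real_norm_sq_eq, Fin.sum_univ_three, Complex.sq_norm, Complex.normSq_apply,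
    hexMap_re, hexMap_im, h0]
  linear_combination (x 1 ^ 2 / 4) * h3

theorem eq_zero_of_hexMap_eq_zero {x : EuclideanSpace ℝ (Fin 3)} (hx : x ∈ sumZeroPlane)
    (h : hexMap x = 0) : x = 0 := by
  have h2 := norm_hexMap_sq hx
  rw [h, norm_zero] at h2
  rw [← norm_eq_zero, ← sq_eq_zero_iff]
  linarith

theorem exists_hexMap_eq (w : ℂ) : ∃ x ∈ sumZeroPlane, hexMap x = w := by
  have h3 : √3 ≠ 0 := by positivity
  refine ⟨!₂[w.im / √3 - w.re, -(w.im * 2 / √3), w.re + w.im / √3], ?_, ?_⟩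
  · change ∑ i, _ = (0 : ℝ)
    rw [Fin.sum_univ_three]
    simp
    ring
  · apply Complex.ext
    · rw [hexMap_re]
      simp
      ring
    · rw [hexMap_im]
      simp
      field_simp

/-- The similarity `x ↦ (x₃ - x₂ ω) / c` of the plane `ℝ³₀` with `ℂ`. -/
noncomputable def hexEquiv (c : ℂ) (hc : c ≠ 0) : sumZeroPlane ≃ₗ[ℝ] ℂ :=
  LinearEquiv.ofBijective ((LinearMap.mulRight ℝ c⁻¹ ∘ₗ hexMap) ∘ₗ sumZeroPlane.subtype) <| by
    constructor
    · rw [← LinearMap.ker_eq_bot, LinearMap.ker_eq_bot']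
      intro x hx
      have h1 : hexMap x = 0 := by simpa [hc] using hx
      exact Subtype.ext (eq_zero_of_hexMap_eq_zero x.2 h1)
    · intro w
      obtain ⟨x, hx, hxw⟩ := exists_hexMap_eq (w * c)
      refine ⟨⟨x, hx⟩, ?_⟩
      change hexMap x * c⁻¹ = w
      rw [hxw, mul_inv_cancel_right₀ hc]

theorem hexEquiv_apply (c : ℂ) (hc : c ≠ 0) (x : sumZeroPlane) :
    hexEquiv c hc x = hexMap x / c := by
  rw [div_eq_mul_inv]
  rfl

theorem isSimilarity_hexEquiv (c : ℂ) (hc : c ≠ 0) : IsSimilarity (hexEquiv c hc) := by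
  have hc' : 0 < ‖c‖ := norm_pos_iff.2 hc
  refine ⟨1 / (√2 * ‖c‖), by positivity, fun x => ?_⟩
  have h2 : ‖hexMap x‖ = ‖x‖ / √2 := by
    rw [← sq_eq_sq₀ (norm_nonneg _) (by positivity), norm_hexMap_sq x.2, div_pow,
      Real.sq_sqrt (by norm_num)]
    rfl
  rw [hexEquiv_apply, norm_div, h2]
  field_simp

/-- The logarithmic map on units, as a homomorphism. -/
noncomputable def unitLog {K : Type} [Field K] (σ : Fin 3 → (K →+* ℝ)) (O : Subring K) :
    Additive Oˣ →+ EuclideanSpace ℝ (Fin 3) :=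
  AddMonoidHom.mk' (fun u => logMap σ ((u.toMul : O) : K)) <| by
    intro u v
    have hne : ∀ (u : Oˣ) i, σ i ((u : O) : K) ≠ 0 := fun u i => by
      rw [map_ne_zero]
      simp
    ext i
    simp [logMap, Real.log_mul, hne]

theorem mem_unitLattice_iff {K : Type} [Field K] (σ : Fin 3 → (K →+* ℝ)) (O : Subring K)
    (x : sumZeroPlane) :
    x ∈ unitLattice σ O ↔ (x : EuclideanSpace ℝ (Fin 3)) ∈ (unitLog σ O).range := by
  constructor
  · rintro ⟨u, hu⟩
    exact ⟨Additive.ofMul u, hu.symm⟩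
  · rintro ⟨u, hu⟩
    exact ⟨u.toMul, hu.symm⟩

theorem logMap_mem_range_unitLog {K : Type} [Field K] (σ : Fin 3 → (K →+* ℝ)) {O : Subring K}
    {x y : K} (hx : x ∈ O) (hy : y ∈ O) (h : x * y = 1) : logMap σ x ∈ (unitLog σ O).range :=
  ⟨Additive.ofMul (Units.mkOfMulEqOne (⟨x, hx⟩ : O) ⟨y, hy⟩ (Subtype.ext h)), rfl⟩

/-- Dividing by `hexMap U` sends `U, V` to `1, z`. Since `z` is not real, they span the plane, and
the covering criterion turns real coordinates of lattice points into integral ones. -/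
theorem isShapeOf_of_range_eq {K : Type} [Field K] (σ : Fin 3 → (K →+* ℝ)) (O : Subring K)
    {U V : EuclideanSpace ℝ (Fin 3)} (hU : U ∈ (unitLog σ O).range) (hV : V ∈ (unitLog σ O).range)
    (hsum : ∀ w ∈ (unitLog σ O).range, w ∈ sumZeroPlane)
    {m M : ℝ} (hmin : ∀ w ∈ (unitLog σ O).range, w ≠ 0 → m ≤ ‖w‖ ^ 2) (hM : M < m)
    (hnu : ‖U‖ ^ 2 ≤ 3 * M) (hnv : ‖V‖ ^ 2 ≤ 3 * M)
    (huv : ‖U - V‖ ^ 2 ≤ 3 * M ∨ ‖U + V‖ ^ 2 ≤ 3 * M) {z : ℍ}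
    (hz : (z : ℂ) = hexMap V / hexMap U) : IsShapeOf (unitLattice σ O) (ModularCurve.mk z) := by
  have hc : hexMap U ≠ 0 := fun h => z.ne_zero (by rw [hz, h, div_zero])
  refine ⟨z, hexEquiv _ hc, rfl, isSimilarity_hexEquiv _ hc, ?_⟩
  ext w
  constructor
  · rintro ⟨x, hx, rfl⟩
    rw [mem_unitLattice_iff] at hx
    obtain ⟨s, t, hst⟩ : ∃ s t : ℝ, hexMap x = s * hexMap U + t * hexMap V := by
      have him := z.im_pos.ne'
      refine ⟨(hexMap x / hexMap U).re - (hexMap x / hexMap U).im / z.im * z.re,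
        (hexMap x / hexMap U).im / z.im, ?_⟩
      have hV' : hexMap V = z * hexMap U := by rw [hz]; field_simp
      rw [hV', ← mul_assoc, ← add_mul, ← div_eq_iff hc]
      apply Complex.ext
      · simp
      · simp [him]
    have hx' : (x : EuclideanSpace ℝ (Fin 3)) = s • U + t • V := by
      rw [← sub_eq_zero]
      have hm : (x : EuclideanSpace ℝ (Fin 3)) - (s • U + t • V) ∈ sumZeroPlane :=
        sub_mem x.2 (add_mem (sumZeroPlane.smul_mem _ (hsum _ hU))
          (sumZeroPlane.smul_mem _ (hsum _ hV)))
      refine eq_zero_of_hexMap_eq_zero hm ?_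
      rw [map_sub, map_add, map_smul, map_smul, hst]
      simp
    rw [hx'] at hx
    obtain ⟨i, j, hij⟩ := AddSubgroup.exists_eq_zsmul_add_zsmul _ hU hV hmin hM hnu hnv huv hx
    refine ⟨i, j, ?_⟩
    rw [hexEquiv_apply, hx', hij, hz, map_add, map_zsmul, map_zsmul]
    simp only [zsmul_eq_mul]
    field_simp
  · rintro ⟨i, j, rfl⟩
    have hm : i • U + j • V ∈ (unitLog σ O).range :=
      add_mem (zsmul_mem hU _) (zsmul_mem hV _)
    refine ⟨⟨i • U + j • V, hsum _ hm⟩, (mem_unitLattice_iff _ _ _).2 hm, ?_⟩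
    rw [hexEquiv_apply, hz]
    simp only [map_add, map_zsmul, zsmul_eq_mul]
    field_simp

-- Units of the cubic order: norm, lower bound, two explicit generators

namespace RealCubic

variable {p q : ℤ} {θ : Fin 3 → ℝ}

/-- Coordinates of the images of an element of `ℤ[θ]` under the three embeddings. -/
theorem exists_embedding_eq (h : RealCubic p q θ) {x : CubicField p q} (hx : x ∈ cubicOrder p q) :
    ∃ c d e : ℤ, ∀ i, h.embedding i x = c + d * θ i + e * θ i ^ 2 := by
  obtain ⟨c, d, e, rfl⟩ := mem_cubicOrder hx
  exact ⟨c, d, e, fun i => by simp⟩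

variable [Fact (Irreducible (unitCubic ℚ p q))]

theorem abs_prod_embedding_eq_one (h : RealCubic p q θ) (u : (cubicOrder p q)ˣ) :
    |h.embedding 0 (u : cubicOrder p q) * h.embedding 1 (u : cubicOrder p q)
      * h.embedding 2 (u : cubicOrder p q)| = 1 := by
  have hint : ∀ u : (cubicOrder p q)ˣ, ∃ n : ℤ, h.embedding 0 (u : cubicOrder p q)
      * h.embedding 1 (u : cubicOrder p q) * h.embedding 2 (u : cubicOrder p q) = n := fun u => by
    obtain ⟨c, d, e, hg⟩ := h.exists_embedding_eq (u : cubicOrder p q).2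
    exact h.exists_int_eq_prod hg
  obtain ⟨m, hm⟩ := hint u
  obtain ⟨n, hn⟩ := hint u⁻¹
  have hinv : ∀ i, h.embedding i (u : cubicOrder p q)
      * h.embedding i ((u⁻¹ : (cubicOrder p q)ˣ) : cubicOrder p q) = 1 := fun i => by
    rw [← map_mul, ← Subring.coe_mul, Units.mul_inv, Subring.coe_one, map_one]
  have hmn : (m : ℝ) * n = 1 := by
    rw [← hm, ← hn]
    calc _ = (h.embedding 0 (u : cubicOrder p q)
          * h.embedding 0 ((u⁻¹ : (cubicOrder p q)ˣ) : cubicOrder p q))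
        * (h.embedding 1 (u : cubicOrder p q)
          * h.embedding 1 ((u⁻¹ : (cubicOrder p q)ˣ) : cubicOrder p q))
        * (h.embedding 2 (u : cubicOrder p q)
          * h.embedding 2 ((u⁻¹ : (cubicOrder p q)ˣ) : cubicOrder p q)) := by ring
      _ = 1 := by rw [hinv, hinv, hinv]; norm_num
  have hu : IsUnit m := IsUnit.of_mul_eq_one n (by exact_mod_cast hmn)
  rw [hm, ← Int.cast_abs, Int.isUnit_iff_abs_eq.1 hu, Int.cast_one]

theorem unitLog_apply (h : RealCubic p q θ) (u : Additive (cubicOrder p q)ˣ) (i : Fin 3) :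
    unitLog h.embedding (cubicOrder p q) u i
      = Real.log |h.embedding i (u.toMul : cubicOrder p q)| := rfl

theorem mem_sumZeroPlane (h : RealCubic p q θ) {w : EuclideanSpace ℝ (Fin 3)}
    (hw : w ∈ (unitLog h.embedding (cubicOrder p q)).range) : w ∈ sumZeroPlane := by
  obtain ⟨u, rfl⟩ := hw
  have h1 := h.abs_prod_embedding_eq_one u.toMul
  have hne : h.embedding 0 (u.toMul : cubicOrder p q) * h.embedding 1 (u.toMul : cubicOrder p q)
      * h.embedding 2 (u.toMul : cubicOrder p q) ≠ 0 := by
    rw [← abs_pos, h1]; exact one_pos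
  have h2 := congrArg Real.log h1
  simp only [ne_eq, mul_eq_zero, not_or] at hne
  rw [abs_mul, abs_mul, Real.log_mul, Real.log_mul, Real.log_one] at h2
  · change ∑ i, _ = (0 : ℝ)
    rw [Fin.sum_univ_three]
    exact h2
  all_goals simp [hne]

theorem sq_le_norm_sq (h : RealCubic p q θ) {l : ℝ} (hl : 0 ≤ l)
    (hd : 8 * Real.exp l ≤ |(θ 0 - θ 1) * (θ 0 - θ 2) * (θ 1 - θ 2)|)
    {w : EuclideanSpace ℝ (Fin 3)} (hw : w ∈ (unitLog h.embedding (cubicOrder p q)).range)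
    (hw0 : w ≠ 0) : l ^ 2 / 2 ≤ ‖w‖ ^ 2 := by
  obtain ⟨u, rfl⟩ := hw
  have h1 := h.abs_prod_embedding_eq_one u.toMul
  obtain ⟨c, d, e, hg⟩ := h.exists_embedding_eq (u.toMul : cubicOrder p q).2
  have hde : d ≠ 0 ∨ e ≠ 0 := by
    by_contra! hde
    obtain ⟨rfl, rfl⟩ := hde
    apply hw0
    have hc : ∀ i, h.embedding i (u.toMul : cubicOrder p q) = c := fun i => by simp [hg]
    -- A rational integer of norm `±1` is `±1`, whose log vector is zero.
    rw [hc, hc, hc] at h1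
    have hc1 : |(c : ℝ)| = 1 := by
      rw [abs_mul, abs_mul, ← pow_three'] at h1
      exact (pow_eq_one_iff_of_nonneg (abs_nonneg _) three_ne_zero).1 h1
    ext i
    rw [h.unitLog_apply, hc, hc1]
    simp
  have := sq_le_two_mul_sum_log_sq h1 hl (hd.trans (h.abs_discr_le hde hg))
  rw [EuclideanSpace.real_norm_sq_eq, Fin.sum_univ_three, h.unitLog_apply, h.unitLog_apply,
    h.unitLog_apply]
  linarith

end RealCubic

/-- The unit lattice of `ℤ[θ]` is generated by the units `θ` and `a θ - b` as soon as these are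
small with respect to the discriminant. -/
theorem RealCubic.mk_mem_unitShapes {p q a b : ℤ} {θ : Fin 3 → ℝ} (h : RealCubic p q θ)
    (hab : b ^ 3 + p * a * b ^ 2 + q * a ^ 2 * b + a ^ 3 = 1) {l M : ℝ} (hl : 0 ≤ l)
    (hd : 8 * Real.exp l ≤ |(θ 0 - θ 1) * (θ 0 - θ 2) * (θ 1 - θ 2)|) (hM : M < l ^ 2 / 2)
    {U V : EuclideanSpace ℝ (Fin 3)} (hU : ∀ i, U i = Real.log |θ i|)
    (hV : ∀ i, V i = Real.log |a * θ i - b|) (hnu : ‖U‖ ^ 2 ≤ 3 * M) (hnv : ‖V‖ ^ 2 ≤ 3 * M)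
    (huv : ‖U - V‖ ^ 2 ≤ 3 * M ∨ ‖U + V‖ ^ 2 ≤ 3 * M) {z : ℍ}
    (hz : (z : ℂ) = hexMap V / hexMap U) : ModularCurve.mk z ∈ unitShapes := by
  have : Fact (Irreducible (unitCubic ℚ p q)) := ⟨h.irreducible⟩
  have hroot := CubicField.root_eq (p := p) (q := q)
  have hr := root_mem_cubicOrder (p := p) (q := q)
  have hi : ∀ n : ℤ, (n : CubicField p q) ∈ cubicOrder p q := fun n => intCast_mem _ n
  refine ⟨CubicField p q, inferInstance, inferInstance, cubicOrder p q, h.embeddingEquiv,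
    h.isTotallyReal, RealCubic.finrank_eq, RealCubic.isOrder, ?_⟩
  refine isShapeOf_of_range_eq h.embedding (cubicOrder p q) ?_ ?_
    (fun w hw => h.mem_sumZeroPlane hw) (fun w hw hw0 => h.sq_le_norm_sq hl hd hw hw0) hM
    hnu hnv huv hz
  · have e : U = logMap h.embedding (AdjoinRoot.root (unitCubic ℚ p q)) := by
      ext i; simp [hU, logMap]
    rw [e]
    set ξ := AdjoinRoot.root (unitCubic ℚ p q)
    refine logMap_mem_range_unitLog _ (y := -(ξ ^ 2 + p * ξ + q)) hr ?_ ?_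
    · exact neg_mem (add_mem (add_mem (pow_mem hr _) (mul_mem (hi _) hr)) (hi _))
    · linear_combination -hroot
  · have e : V = logMap h.embedding (a * AdjoinRoot.root (unitCubic ℚ p q) - b) := by
      ext i; simp [hV, logMap]
    rw [e]
    set ξ := AdjoinRoot.root (unitCubic ℚ p q)
    have hab' : (b : CubicField p q) ^ 3 + p * a * b ^ 2 + q * a ^ 2 * b + a ^ 3 = 1 := by
      exact_mod_cast congrArg (Int.cast : ℤ → CubicField p q) hab
    -- The inverse is minus the quotient of `a³ f(x) - a³ f(b/a)` by `a x - b`, since `f(ξ) = 0` and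
    -- `a³ f(b/a) = 1`.
    refine logMap_mem_range_unitLog _ (y := -((a ^ 2 : ℤ) * ξ ^ 2 + (a * b + a ^ 2 * p : ℤ) * ξ
      + (b ^ 2 + a * b * p + a ^ 2 * q : ℤ))) (sub_mem (mul_mem (hi _) hr) (hi _)) ?_ ?_
    · exact neg_mem (add_mem (add_mem (mul_mem (hi _) (pow_mem hr _)) (mul_mem (hi _) hr)) (hi _))
    · push_cast
      linear_combination (-(a : CubicField p q) ^ 3) * hroot + hab'

-- The curve stays in the upper half-plane

theorem shapeCurve_im_pos {α β r : ℝ} (hα : 0 ≤ α) (hβ : 0 ≤ β) (hr : 0 ≤ r) :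
    0 < (shapeCurve α β r).im := by
  have hA := mul_nonneg hr hα
  have hB := mul_nonneg hr hβ
  have e : shapeCurve α β r
      = (((1 + 2 * (r * α) : ℝ) : ℂ) + ((1 + r * β + 2 * (r * α) : ℝ) : ℂ) * omega)
        / (((1 + r * α : ℝ) : ℂ) + ((r * α - r * β : ℝ) : ℂ) * omega) := by
    simp only [shapeCurve]
    push_cast
    ring
  rw [e]
  generalize r * α = A at *
  generalize r * β = B at *
  have h3 : (√3) ^ 2 = 3 := Real.sq_sqrt (by norm_num)
  have h3' : 0 < √3 := by positivity
  have hd : Complex.normSq (((1 + A : ℝ) : ℂ) + ((A - B : ℝ) : ℂ) * omega)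
      = (1 + A) ^ 2 - (1 + A) * (A - B) + (A - B) ^ 2 := by
    rw [Complex.normSq_apply]
    simp only [Complex.add_re, Complex.add_im, Complex.re_ofReal_mul, Complex.im_ofReal_mul,
      Complex.ofReal_re, Complex.ofReal_im, omega_re, omega_im]
    linear_combination ((A - B) ^ 2 / 4) * h3
  have hpos : 0 < (1 + A) ^ 2 - (1 + A) * (A - B) + (A - B) ^ 2 := by
    nlinarith [sq_nonneg ((1 + A) - 2 * (A - B))]
  rw [Complex.div_im, hd, ← sub_div]
  refine div_pos ?_ hpos
  simp only [Complex.add_re, Complex.add_im, Complex.re_ofReal_mul, Complex.im_ofReal_mul,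
      Complex.ofReal_re, Complex.ofReal_im, omega_re, omega_im]
  have : 0 < √3 / 2 * (1 + 2 * A + 2 * B + 3 * (A * B)) := by positivity
  linarith

-- The family of cubics attached to a pair, and the sizes of roots and units

theorem exists_cubic_eq_zero {c₀ c₁ c₂ c₃ : ℝ}
    (h : (c₃ / 8 + c₂ / 4 + c₁ / 2 + c₀ ≤ 0 ∧ 0 ≤ 8 * c₃ + 4 * c₂ + 2 * c₁ + c₀) ∨
      (0 ≤ c₃ / 8 + c₂ / 4 + c₁ / 2 + c₀ ∧ 8 * c₃ + 4 * c₂ + 2 * c₁ + c₀ ≤ 0)) :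
    ∃ y : ℝ, 1 / 2 ≤ y ∧ y ≤ 2 ∧ c₃ * y ^ 3 + c₂ * y ^ 2 + c₁ * y + c₀ = 0 := by
  have hc : ContinuousOn (fun y : ℝ => c₃ * y ^ 3 + c₂ * y ^ 2 + c₁ * y + c₀)
      (Set.Icc (1 / 2) 2) := by fun_prop
  have hle : (1 / 2 : ℝ) ≤ 2 := by norm_num
  rcases h with h | h
  · obtain ⟨y, hy, hy0⟩ := intermediate_value_Icc hle hc
      (show (0 : ℝ) ∈ _ from ⟨by linarith, by linarith⟩)
    exact ⟨y, hy.1, hy.2, hy0⟩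
  · obtain ⟨y, hy, hy0⟩ := intermediate_value_Icc' hle hc
      (show (0 : ℝ) ∈ _ from ⟨by linarith, by linarith⟩)
    exact ⟨y, hy.1, hy.2, hy0⟩

theorem IsMutuallyCubicRootPair.isCoprime {a b : ℤ} (h : IsMutuallyCubicRootPair a b) :
    IsCoprime a b := by
  obtain ⟨c, hc⟩ := h.1.dvd
  exact ⟨a ^ 2, c, by linear_combination -hc⟩

/-- The one-parameter family of cubics for which `θ` and `a θ - b` are units. -/
theorem IsMutuallyCubicRootPair.exists_coeff {a b : ℤ} (h : IsMutuallyCubicRootPair a b)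
    (ha : a ≠ 0) (hb : b ≠ 0) (K : ℝ) :
    ∃ p q : ℤ, b ^ 3 + p * a * b ^ 2 + q * a ^ 2 * b + a ^ 3 = 1 ∧ |p - a * K| ≤ |(a : ℝ)| ∧
      |q + b * K| ≤ |(b : ℝ)| * (2 + |(a : ℝ)| + |(b : ℝ)|) := by
  obtain ⟨x, y, hxy⟩ := h.isCoprime
  obtain ⟨c, hc⟩ : a * b ∣ 1 - a ^ 3 - b ^ 3 := by
    refine h.isCoprime.mul_dvd ?_ ?_
    · have := h.2.dvd
      rw [show 1 - a ^ 3 - b ^ 3 = (1 - b ^ 3) - a * a ^ 2 by ring]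
      exact dvd_sub this (dvd_mul_right _ _)
    · have := h.1.dvd
      rw [show 1 - a ^ 3 - b ^ 3 = (1 - a ^ 3) - b * b ^ 2 by ring]
      exact dvd_sub this (dvd_mul_right _ _)
  have ha' : (a : ℝ) ≠ 0 := by exact_mod_cast ha
  have hb' : (b : ℝ) ≠ 0 := by exact_mod_cast hb
  -- The equation amounts to `p b + q a = c`, with solutions `p = cy + aj`, `q = cx - bj`. This `j`
  -- brings `p` within `|a|` of `aK`.
  set j : ℤ := ⌊K - c * y / a⌋
  have hp : |((c * y + a * j : ℤ) : ℝ) - a * K| ≤ |(a : ℝ)| := by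
    have e : ((c * y + a * j : ℤ) : ℝ) - a * K = a * (-Int.fract (K - c * y / a)) := by
      rw [show Int.fract (K - c * y / a) = K - c * y / a - j from rfl]
      push_cast
      field_simp
      ring
    rw [e, abs_mul, abs_neg, Int.abs_fract]
    exact mul_le_of_le_one_right (abs_nonneg _) (Int.fract_lt_one _).le
  refine ⟨c * y + a * j, c * x - b * j, ?_, hp, ?_⟩
  · linear_combination -hc + a * b * c * hxy
  · have hcr : (1 : ℝ) - a ^ 3 - b ^ 3 = a * b * c := by exact_mod_cast hc
    have hxr : (x : ℝ) * a + y * b = 1 := by exact_mod_cast hxy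
    have e : ((c * x - b * j : ℤ) : ℝ) + b * K = (1 - a ^ 3 - b ^ 3) / (a ^ 2 * b)
        - b * ((((c * y + a * j : ℤ) : ℝ) - a * K) / a) := by
      rw [hcr]
      push_cast
      field_simp
      linear_combination (c : ℝ) * hxr
    have h1 : |(((c * y + a * j : ℤ) : ℝ) - a * K) / a| ≤ 1 := by
      rw [abs_div]
      exact div_le_one_of_le₀ hp (abs_nonneg _)
    have h2 : |((1 : ℝ) - a ^ 3 - b ^ 3) / (a ^ 2 * b)|
        ≤ |(b : ℝ)| * (1 + |(a : ℝ)| + |(b : ℝ)|) := by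
      have ha1 : (1 : ℝ) ≤ |(a : ℝ)| := by exact_mod_cast Int.one_le_abs ha
      have hb1 : (1 : ℝ) ≤ |(b : ℝ)| := by exact_mod_cast Int.one_le_abs hb
      rw [abs_div, abs_mul, abs_pow, div_le_iff₀ (by positivity)]
      have h3 : |(1 : ℝ) - a ^ 3 - b ^ 3| ≤ 1 + |(a : ℝ)| ^ 3 + |(b : ℝ)| ^ 3 := by
        rw [← abs_pow, ← abs_pow]
        have := abs_sub (1 - (a : ℝ) ^ 3) ((b : ℝ) ^ 3)
        have := abs_sub 1 ((a : ℝ) ^ 3)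
        rw [abs_one] at this
        linarith
      refine h3.trans ?_
      generalize |(a : ℝ)| = s at *
      generalize |(b : ℝ)| = t at *
      have hs2 : 1 ≤ s ^ 2 := one_le_pow₀ ha1
      have ht2 : 1 ≤ t ^ 2 := one_le_pow₀ hb1
      have e1 : 1 ≤ s ^ 2 * t ^ 2 := one_le_mul_of_one_le_of_one_le hs2 ht2
      have e2 : s ^ 3 ≤ s ^ 3 * t ^ 2 := le_mul_of_one_le_right (by positivity) ht2
      have e3 : t ^ 3 ≤ t ^ 3 * s ^ 2 := le_mul_of_one_le_right (by positivity) hs2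
      nlinarith
    rw [e]
    refine (abs_sub _ _).trans ?_
    rw [abs_mul]
    have := mul_le_mul_of_nonneg_left h1 (abs_nonneg (b : ℝ))
    linarith

theorem abs_log_le_log_four {x : ℝ} (h1 : 1 / 4 ≤ x) (h2 : x ≤ 4) : |Real.log x| ≤ Real.log 4 := by
  rw [abs_le]
  constructor
  · rw [← Real.log_inv]
    exact Real.log_le_log (by norm_num) (by linarith)
  · exact Real.log_le_log (by linarith) h2

/-- These are the edge conditions of the covering criterion for the limits of `U`, `V`, `U - V` and
`U + V` after division by `k`, with `(2 + A + B)²/2` the limiting lower bound for unit vectors. -/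
theorem shape_inequalities {A B : ℝ} (hA : 0 ≤ A) (hAB : A ≤ B) (hA3 : 3 * A ≤ 1) (hB : B ≤ 1) :
    (-1 - B) ^ 2 + (B - A) ^ 2 + (1 + A) ^ 2 < 3 * ((2 + A + B) ^ 2 / 2) ∧
    B ^ 2 + (-(1 + B + 2 * A)) ^ 2 + (1 + 2 * A) ^ 2 < 3 * ((2 + A + B) ^ 2 / 2) ∧
    ((-1 - B - B) ^ 2 + (B - A - -(1 + B + 2 * A)) ^ 2 + (1 + A - (1 + 2 * A)) ^ 2
        < 3 * ((2 + A + B) ^ 2 / 2) ∨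
      (-1 - B + B) ^ 2 + (B - A + -(1 + B + 2 * A)) ^ 2 + (1 + A + (1 + 2 * A)) ^ 2
        < 3 * ((2 + A + B) ^ 2 / 2)) := by
  refine ⟨by nlinarith, by nlinarith, ?_⟩
  by_contra! h
  obtain ⟨h1, h2⟩ := h
  -- If the edge `U + V` is too long, then `(2 + A + B)² ≤ 4 + 12A + 12A²`, which for `A ≤ 1/3`
  -- forces `B ≤ 13A/6`. For such `B` the edge `U - V` is short enough.
  have hd : B ≤ 2 * A + A / 6 := by
    nlinarith
  nlinarith

/-- Vieta's formulas for a cubic with three distinct roots. -/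
theorem vieta_of_three_roots {p q x y z : ℝ} (hxy : x ≠ y) (hxz : x ≠ z) (hyz : y ≠ z)
    (hx : x ^ 3 + p * x ^ 2 + q * x + 1 = 0) (hy : y ^ 3 + p * y ^ 2 + q * y + 1 = 0)
    (hz : z ^ 3 + p * z ^ 2 + q * z + 1 = 0) :
    x + y + z = -p ∧ x * y + x * z + y * z = q ∧ x * y * z = -1 := by
  have h1 : x ^ 2 + x * y + y ^ 2 + p * (x + y) + q = 0 := by
    apply mul_left_cancel₀ (sub_ne_zero.2 hxy)
    linear_combination hx - hy
  have h2 : x ^ 2 + x * z + z ^ 2 + p * (x + z) + q = 0 := by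
    apply mul_left_cancel₀ (sub_ne_zero.2 hxz)
    linear_combination hx - hz
  have h3 : x + y + z + p = 0 := by
    apply mul_left_cancel₀ (sub_ne_zero.2 hyz)
    linear_combination h1 - h2
  have h4 : x * y + x * z + y * z = q := by
    linear_combination (x + y) * h3 - h1
  exact ⟨by linarith, h4, by linear_combination hx - x ^ 2 * h3 + x * h4⟩

/-- For `K` large with respect to `a` and `b`, the roots of the cubic have orders of magnitude
`1 / (b K)`, `b / a` and `a K`. -/
theorem exists_roots_of_approx {a b p q K : ℝ} (ha : 1 ≤ |a|) (hb : 1 ≤ |b|)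
    (hK : 100 * (2 + |a| + |b|) ≤ K) (hp : |p - a * K| ≤ |a|)
    (hq : |q + b * K| ≤ |b| * (2 + |a| + |b|)) :
    ∃ y : Fin 3 → ℝ, (∀ i, 1 / 2 ≤ y i ∧ y i ≤ 2) ∧
      ∀ x, x = y 0 / (b * K) ∨ x = y 1 * (b / a) ∨ x = -(y 2 * (a * K)) →
        x ^ 3 + p * x ^ 2 + q * x + 1 = 0 := by
  have ha0 : a ≠ 0 := by rintro rfl; simp at ha; linarith
  have hb0 : b ≠ 0 := by rintro rfl; simp at hb; linarith
  have hK0 : 0 < K := by linarith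
  have hpow : ∀ c : ℝ, 1 ≤ |c| → |1 / (c * K) ^ 3| ≤ 1 / 100 := fun c hc => by
    have hcK : 100 ≤ |c * K| := by
      rw [abs_mul, abs_of_pos hK0]
      nlinarith
    rw [abs_div, abs_one, abs_pow]
    apply one_div_le_one_div_of_le (by norm_num)
    nlinarith [pow_le_pow_left₀ (by norm_num) hcK 3]
  have hsmall : ∀ c d : ℝ, 1 ≤ |d| → 100 * |c| ≤ K → |c / (d ^ 2 * K)| ≤ 1 / 100 :=
      fun c d hd hc => by
    rw [abs_div, abs_mul, abs_pow, abs_of_pos hK0, div_le_iff₀ (by positivity)]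
    nlinarith [one_le_pow₀ hd (n := 2)]
  obtain ⟨P, hP⟩ : ∃ P, P = p / (a * K) := ⟨_, rfl⟩
  obtain ⟨Q, hQ⟩ : ∃ Q, Q = q / (b * K) := ⟨_, rfl⟩
  obtain ⟨s, hs⟩ : ∃ s, s = a / (b ^ 2 * K) := ⟨_, rfl⟩
  obtain ⟨w, hw⟩ : ∃ w, w = b / (a ^ 2 * K) := ⟨_, rfl⟩
  obtain ⟨e, he⟩ : ∃ e, e = 1 / (b * K) ^ 3 := ⟨_, rfl⟩
  obtain ⟨f, hf⟩ : ∃ f, f = 1 / (a * K) ^ 3 := ⟨_, rfl⟩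
  have hPp : p = P * (a * K) := by rw [hP]; field_simp
  have hQq : q = Q * (b * K) := by rw [hQ]; field_simp
  have be := hpow b hb
  have bf := hpow a ha
  have bs := hsmall a b hb (by linarith [abs_nonneg b])
  have bw := hsmall b a ha (by linarith [abs_nonneg a])
  have bP : |P - 1| ≤ 1 / 100 := by
    rw [hPp, ← sub_one_mul, abs_mul, abs_mul, abs_of_pos hK0] at hp
    have hk : (|P - 1| * K) * |a| ≤ 1 * |a| := by linarith
    have := le_of_mul_le_mul_right hk (by linarith)
    nlinarith [abs_nonneg (P - 1)]
  have bQ : |Q + 1| ≤ 1 / 100 := by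
    rw [hQq, ← add_one_mul, abs_mul, abs_mul, abs_of_pos hK0] at hq
    have hk : (|Q + 1| * K) * |b| ≤ (K / 100) * |b| := by nlinarith
    have := le_of_mul_le_mul_right hk (by linarith)
    nlinarith [abs_nonneg (Q + 1)]
  rw [← he] at be
  rw [← hf] at bf
  rw [← hs] at bs
  rw [← hw] at bw
  have hprod : ∀ u v : ℝ, |u| ≤ 2 → |v| ≤ 1 / 100 → |u * v| ≤ 1 / 50 := fun u v hu hv => by
    rw [abs_mul]
    nlinarith [abs_nonneg u, abs_nonneg v]
  have bPs := hprod P s (by rw [abs_le] at bP ⊢; constructor <;> linarith) bs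
  have bQw := hprod Q w (by rw [abs_le] at bQ ⊢; constructor <;> linarith) bw
  rw [abs_le] at be bf bs bw bP bQ bPs bQw
  -- In units of the expected root sizes, the cubic is a small perturbation of `1 - y`, `y² - y` and
  -- `y² - y³` respectively. Each changes sign at `y = 1`, between 1/2 and 2.
  obtain ⟨y₀, h0, h0', e0⟩ := exists_cubic_eq_zero (c₃ := e) (c₂ := P * s) (c₁ := Q) (c₀ := 1)
    (.inr ⟨by linarith, by linarith⟩)
  obtain ⟨y₁, h1, h1', e1⟩ := exists_cubic_eq_zero (c₃ := w) (c₂ := P) (c₁ := Q) (c₀ := s)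
    (.inl ⟨by linarith, by linarith⟩)
  obtain ⟨y₂, h2, h2', e2⟩ := exists_cubic_eq_zero (c₃ := -1) (c₂ := P) (c₁ := -(Q * w)) (c₀ := f)
    (.inr ⟨by linarith, by linarith⟩)
  refine ⟨![y₀, y₁, y₂], fun i => by
    fin_cases i; exacts [⟨h0, h0'⟩, ⟨h1, h1'⟩, ⟨h2, h2'⟩], fun x hx => ?_⟩
  simp only [Matrix.cons_val] at hx
  rcases hx with rfl | rfl | rfl
  · rw [← e0, he, hs, hPp, hQq]
    field_simp
  · have : (a / (b ^ 2 * K)) * ((y₁ * (b / a)) ^ 3 + p * (y₁ * (b / a)) ^ 2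
        + q * (y₁ * (b / a)) + 1) = 0 := by
      rw [← e1, hw, hs, hPp, hQq]
      field_simp
    exact (mul_eq_zero.1 this).resolve_left (by positivity)
  · have : (1 / (a * K) ^ 3) * ((-(y₂ * (a * K))) ^ 3 + p * (-(y₂ * (a * K))) ^ 2
        + q * (-(y₂ * (a * K))) + 1) = 0 := by
      rw [← e2, hw, hf, hPp, hQq]
      field_simp
    exact (mul_eq_zero.1 this).resolve_left (by positivity)

/-- Compares consecutive roots, whose ratio is `c` up to the factors `t` and `y` of order one. -/
theorem le_half_of_mul_eq {u v y t c : ℝ} (hu : 0 ≤ u) (hv : 0 ≤ v) (hy : 1 / 2 ≤ y)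
    (ht : 0 ≤ t) (ht' : t ≤ 2) (hc' : c ≤ 1 / 100) (h : u * y = c * t * v) :
    u ≤ v / 2 := by
  have h1 : c * t ≤ 1 / 4 := by nlinarith
  have h2 := mul_le_mul_of_nonneg_right h1 hv
  have h3 := mul_le_mul_of_nonneg_left hy hu
  linarith

theorem abs_mul_sub_log_le {x y c C : ℝ} (hy : 0 < c) (h1 : 1 / 4 ≤ y) (h2 : y ≤ 4)
    (hx : x = y * c) (hC : C = Real.log c) : |Real.log x - C| ≤ Real.log 4 := by
  rw [hx, hC, Real.log_mul (by linarith) hy.ne', add_sub_cancel_right]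
  exact abs_log_le_log_four h1 h2

-- `U` and `V` are the log vectors of `θ` and `aθ - b`. The final clause leaves `M` free, so that it
-- can be chosen from the limiting inequalities.
set_option maxHeartbeats 2000000 in
theorem IsMutuallyCubicRootPair.exists_unitShape {a b : ℤ} (h : IsMutuallyCubicRootPair a b)
    (ha : a ≠ 0) (hb : b ≠ 0) {K A B k : ℝ} (hK : 100 * (2 + |(a : ℝ)| + |(b : ℝ)|) ≤ K)
    (hA : A = Real.log |(a : ℝ)|) (hB : B = Real.log |(b : ℝ)|) (hk : k = Real.log K) :
    ∃ U V : EuclideanSpace ℝ (Fin 3),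
      |U 0 - -(B + k)| ≤ 2 * Real.log 4 ∧ |U 1 - (B - A)| ≤ 2 * Real.log 4 ∧
      |U 2 - (A + k)| ≤ 2 * Real.log 4 ∧ |V 0 - B| ≤ 2 * Real.log 4 ∧
      |V 1 - -(B + 2 * A + k)| ≤ 2 * Real.log 4 ∧ |V 2 - (2 * A + k)| ≤ 2 * Real.log 4 ∧
      ∀ M, 0 ≤ A + B + 2 * k - Real.log 512 → M < (A + B + 2 * k - Real.log 512) ^ 2 / 2 →
        ‖U‖ ^ 2 ≤ 3 * M → ‖V‖ ^ 2 ≤ 3 * M → (‖U - V‖ ^ 2 ≤ 3 * M ∨ ‖U + V‖ ^ 2 ≤ 3 * M) →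
        ∀ z : ℍ, (z : ℂ) = hexMap V / hexMap U → ModularCurve.mk z ∈ unitShapes := by
  obtain ⟨p, q, hpq, hp, hq⟩ := h.exists_coeff ha hb K
  have ha1 : (1 : ℝ) ≤ |(a : ℝ)| := by exact_mod_cast Int.one_le_abs ha
  have hb1 : (1 : ℝ) ≤ |(b : ℝ)| := by exact_mod_cast Int.one_le_abs hb
  have ha0 : (a : ℝ) ≠ 0 := by exact_mod_cast ha
  have hb0 : (b : ℝ) ≠ 0 := by exact_mod_cast hb
  have hK0 : 0 < K := by linarith
  obtain ⟨y, hy, hroot⟩ := exists_roots_of_approx ha1 hb1 hK hp hq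
  obtain ⟨θ, h0, h1, h2⟩ : ∃ θ : Fin 3 → ℝ, θ 0 = y 0 / (b * K) ∧ θ 1 = y 1 * (b / a) ∧
      θ 2 = -(y 2 * (a * K)) :=
    ⟨![y 0 / (b * K), y 1 * (b / a), -(y 2 * (a * K))], rfl, rfl, rfl⟩
  have hr0 := hroot _ (.inl h0)
  have hr1 := hroot _ (.inr (.inl h1))
  have hr2 := hroot _ (.inr (.inr h2))
  obtain ⟨hy0, hy0'⟩ := hy 0
  obtain ⟨hy1, hy1'⟩ := hy 1
  obtain ⟨hy2, hy2'⟩ := hy 2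
  have hl4 : 0 ≤ Real.log 4 := Real.log_nonneg (by norm_num)
  have hsmall : ∀ c d : ℝ, 1 ≤ |d| → 100 * |c| ≤ K → |c / (d ^ 2 * K)| ≤ 1 / 100 :=
      fun c d hd hc => by
    rw [abs_div, abs_mul, abs_pow, abs_of_pos hK0, div_le_iff₀ (by positivity)]
    linarith [le_mul_of_one_le_left hK0.le (one_le_pow₀ hd (n := 2))]
  have bs := hsmall a b hb1 (by linarith)
  have bw := hsmall b a ha1 (by linarith)
  have haK : K ≤ |(a : ℝ)| * K := le_mul_of_one_le_left hK0.le ha1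
  have haK2 : K ≤ |(a : ℝ)| ^ 2 * K := le_mul_of_one_le_left hK0.le (one_le_pow₀ ha1)
  have hbK : K ≤ |(b : ℝ)| * K := le_mul_of_one_le_left hK0.le hb1
  -- absolute values of the roots and their sizes relative to each other
  have a0 : |θ 0| = y 0 * (1 / (|(b : ℝ)| * K)) := by
    rw [h0, abs_div, abs_mul, abs_of_pos hK0, abs_of_pos (by linarith : 0 < y 0)]; ring
  have a1 : |θ 1| = y 1 * (|(b : ℝ)| / |(a : ℝ)|) := by
    rw [h1, abs_mul, abs_div, abs_of_pos (by linarith : 0 < y 1)]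
  have a2 : |θ 2| = y 2 * (|(a : ℝ)| * K) := by
    rw [h2, abs_neg, abs_mul, abs_mul, abs_of_pos hK0, abs_of_pos (by linarith : 0 < y 2)]
  have r01 : |θ 0| ≤ |θ 1| / 2 := by
    have e : θ 0 * y 1 = (a / (b ^ 2 * K)) * y 0 * θ 1 := by
      rw [h0, h1]; field_simp
    have e' := congrArg abs e
    rw [abs_mul, abs_mul, abs_mul, abs_of_pos (by linarith : 0 < y 0),
      abs_of_pos (by linarith : 0 < y 1)] at e'
    exact le_half_of_mul_eq (abs_nonneg _) (abs_nonneg _) hy1 (by linarith) hy0' bs e'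
  have r12 : |θ 1| ≤ |θ 2| / 2 := by
    have e : θ 1 * y 2 = -((b / (a ^ 2 * K)) * y 1 * θ 2) := by
      rw [h1, h2]; field_simp
    have e' := congrArg abs e
    rw [abs_neg, abs_mul, abs_mul, abs_mul, abs_of_pos (by linarith : 0 < y 1),
      abs_of_pos (by linarith : 0 < y 2)] at e'
    exact le_half_of_mul_eq (abs_nonneg _) (abs_nonneg _) hy2 (by linarith) hy1' bw e'
  have p1 : 0 < |θ 1| := by rw [a1]; positivity
  have p2 : 0 < |θ 2| := by rw [a2]; positivity
  have d01 : |θ 1| / 2 ≤ |θ 0 - θ 1| := by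
    linarith [abs_sub_abs_le_abs_sub (θ 1) (θ 0), abs_sub_comm (θ 0) (θ 1)]
  have d02 : |θ 2| / 2 ≤ |θ 0 - θ 2| := by
    linarith [abs_sub_abs_le_abs_sub (θ 2) (θ 0), abs_sub_comm (θ 0) (θ 2)]
  have d12 : |θ 2| / 2 ≤ |θ 1 - θ 2| := by
    linarith [abs_sub_abs_le_abs_sub (θ 2) (θ 1), abs_sub_comm (θ 1) (θ 2)]
  have n01 : θ 0 ≠ θ 1 := sub_ne_zero.1 (abs_pos.1 (by linarith))
  have n02 : θ 0 ≠ θ 2 := sub_ne_zero.1 (abs_pos.1 (by linarith))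
  have n12 : θ 1 ≠ θ 2 := sub_ne_zero.1 (abs_pos.1 (by linarith))
  obtain ⟨v1, v2, v3⟩ := vieta_of_three_roots n01 n02 n12 hr0 hr1 hr2
  -- the unit `a θ - b`
  have hpq' : (b : ℝ) ^ 3 + p * a * b ^ 2 + q * a ^ 2 * b + a ^ 3 = 1 := by exact_mod_cast hpq
  have hprod : (a * θ 0 - b) * (a * θ 1 - b) * (a * θ 2 - b) = -1 := by
    linear_combination (a : ℝ) ^ 3 * v3 - a ^ 2 * b * v2 + a * b ^ 2 * v1 - hpq'
  obtain ⟨t0, ht0, ht0', b0⟩ : ∃ t, 1 / 2 ≤ t ∧ t ≤ 2 ∧ |a * θ 0 - b| = t * |(b : ℝ)| := by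
    have hys : |y 0 * (a / (b ^ 2 * K))| ≤ 2 * (1 / 100) := by
      rw [abs_mul, abs_of_pos (by linarith : 0 < y 0)]
      exact mul_le_mul hy0' bs (abs_nonneg _) (by norm_num)
    rw [abs_le] at hys
    refine ⟨|y 0 * (a / (b ^ 2 * K)) - 1|, ?_, ?_, ?_⟩
    · rw [abs_of_nonpos (by linarith)]
      linarith
    · rw [abs_of_nonpos (by linarith)]
      linarith
    · rw [← abs_mul, h0]
      congr 1
      field_simp
  obtain ⟨t2, ht2, ht2', b2⟩ : ∃ t, 1 / 4 ≤ t ∧ t ≤ 4 ∧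
      |a * θ 2 - b| = t * (|(a : ℝ)| ^ 2 * K) := by
    rw [abs_le] at bw
    refine ⟨y 2 + b / (a ^ 2 * K), by linarith, by linarith, ?_⟩
    have e : a * θ 2 - b = -((y 2 + b / (a ^ 2 * K)) * (a ^ 2 * K)) := by
      rw [h2]; field_simp; ring
    rw [e, abs_neg, abs_mul, abs_of_pos (by linarith : 0 < y 2 + b / (a ^ 2 * K)), sq_abs,
      abs_of_pos (by positivity)]
  have hprod' : |a * θ 0 - b| * |a * θ 1 - b| * |a * θ 2 - b| = 1 := by
    rw [← abs_mul, ← abs_mul, hprod, abs_neg, abs_one]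
  have c0 : |a * θ 0 - b| ≠ 0 := by rintro h; simp [h] at hprod'
  have c1 : |a * θ 1 - b| ≠ 0 := by rintro h; simp [h] at hprod'
  have c2 : |a * θ 2 - b| ≠ 0 := by rintro h; simp [h] at hprod'
  have hsum : Real.log |a * θ 0 - b| + Real.log |a * θ 1 - b| + Real.log |a * θ 2 - b| = 0 := by
    rw [← Real.log_mul c0 c1, ← Real.log_mul (mul_ne_zero c0 c1) c2, hprod', Real.log_one]
  -- no integral roots
  have hnot : ∀ n : ℤ, n ^ 3 + p * n ^ 2 + q * n + 1 ≠ 0 := by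
    intro n hn
    have hn' : (n : ℝ) ^ 3 + p * n ^ 2 + q * n + 1 = 0 := by exact_mod_cast hn
    have hunit : |n| = 1 := by
      rw [← Int.isUnit_iff_abs_eq]
      exact IsUnit.of_mul_eq_one (-(n ^ 2 + p * n + q)) (by linear_combination -hn)
    have hunit' : |(n : ℝ)| = 1 := by exact_mod_cast hunit
    have hz : ((n : ℝ) - θ 0) * (n - θ 1) * (n - θ 2) = 0 := by
      linear_combination hn' - (n : ℝ) ^ 2 * v1 + n * v2 - v3
    rcases mul_eq_zero.1 hz with hz | hz
    · rcases mul_eq_zero.1 hz with hz | hz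
      · rw [sub_eq_zero.1 hz, a0, mul_one_div, div_eq_one_iff_eq (by positivity)] at hunit'
        linarith
      -- If the middle root were an integer, `aθ₁ - b` would be a nonzero integer. The product of
      -- the three conjugates would then be at least 25, not 1 in absolute value.
      · have hm : (1 : ℝ) ≤ |a * θ 1 - b| := by
          rw [← sub_eq_zero.1 hz] at c1 ⊢
          have : a * n - b ≠ 0 := fun h0 => c1 (by
            rw [abs_eq_zero]; exact_mod_cast h0)
          exact_mod_cast Int.one_le_abs this
        have g0 : 1 / 2 ≤ |a * θ 0 - b| := by
          rw [b0]
          linarith [mul_le_mul ht0 hb1 zero_le_one (by linarith)]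
        have g2 : 50 ≤ |a * θ 2 - b| := by
          rw [b2]
          have : 200 ≤ |(a : ℝ)| ^ 2 * K := by linarith
          linarith [mul_le_mul ht2 this (by norm_num) (by linarith)]
        have : 1 / 2 * 1 * 50 ≤ |a * θ 0 - b| * |a * θ 1 - b| * |a * θ 2 - b| := by gcongr
        linarith
    · rw [sub_eq_zero.1 hz, a2] at hunit'
      have : 200 ≤ |(a : ℝ)| * K := by linarith
      linarith [mul_le_mul hy2 this (by norm_num) (by linarith)]
  have hθ : RealCubic p q θ := by
    refine ⟨?_, v1, v2, v3, hnot⟩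
    intro i j hij
    fin_cases i <;> fin_cases j <;> simp_all
  refine ⟨WithLp.toLp 2 fun i => Real.log |θ i|, WithLp.toLp 2 fun i => Real.log |a * θ i - b|,
    ?_, ?_, ?_, ?_, ?_, ?_, ?_⟩
  · refine (abs_mul_sub_log_le (by positivity) (by linarith) (by linarith) a0 ?_).trans
      (by linarith)
    rw [hB, hk, one_div, Real.log_inv, Real.log_mul (by positivity) hK0.ne']
  · refine (abs_mul_sub_log_le (by positivity) (by linarith) (by linarith) a1 ?_).trans
      (by linarith)
    rw [hB, hA, Real.log_div (by positivity) (by positivity)]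
  · refine (abs_mul_sub_log_le (by positivity) (by linarith) (by linarith) a2 ?_).trans
      (by linarith)
    rw [hk, hA, Real.log_mul (by positivity) hK0.ne']
  · exact (abs_mul_sub_log_le (by positivity) (by linarith) (by linarith) b0 hB).trans
      (by linarith)
  -- `aθ₁ - b` is a difference with cancellation, so its size comes from the other two conjugates.
  -- Their errors add up to `2 log 4`.
  · have l0 := abs_mul_sub_log_le (by positivity) (by linarith) (by linarith) b0 hB
    have l2 := abs_mul_sub_log_le (C := 2 * A + k) (by positivity) ht2 ht2' b2 (by
      rw [hk, hA, Real.log_mul (by positivity) hK0.ne', Real.log_pow]; norm_num)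
    change |Real.log |a * θ 1 - b| - _| ≤ _
    rw [abs_le] at l0 l2 ⊢
    constructor <;> linarith
  · refine (abs_mul_sub_log_le (by positivity) ht2 ht2' b2 ?_).trans (by linarith)
    rw [hk, hA, Real.log_mul (by positivity) hK0.ne', Real.log_pow]; norm_num
  · intro M hl hM hnu hnv huv z hz
    refine hθ.mk_mem_unitShapes hpq hl ?_ hM (fun i => rfl) (fun i => rfl) hnu hnv huv hz
    rw [abs_mul, abs_mul]
    have hdisc : |θ 1| / 2 * (|θ 2| / 2) * (|θ 2| / 2)
        ≤ |θ 0 - θ 1| * |θ 0 - θ 2| * |θ 1 - θ 2| := by gcongr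
    refine le_trans ?_ hdisc
    -- Here 512 = 8·8·8: the factor 8 in the unit bound, the three halvings of root differences, and
    -- `y₁ y₂² ≥ 1/8`.
    have hexp : Real.exp (A + B + 2 * k - Real.log 512)
        = |(a : ℝ)| * |(b : ℝ)| * K ^ 2 / 512 := by
      rw [Real.exp_sub, Real.exp_add, Real.exp_add, two_mul, Real.exp_add, hA, hB, hk,
        Real.exp_log (by positivity), Real.exp_log (by positivity), Real.exp_log hK0,
        Real.exp_log (by norm_num)]
      ring
    have e : |θ 1| / 2 * (|θ 2| / 2) * (|θ 2| / 2)
        = (y 1 * y 2 ^ 2) * (|(a : ℝ)| * |(b : ℝ)| * K ^ 2 / 8) := by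
      rw [a1, a2]; field_simp
      norm_num
    have hy3 : 1 / 8 ≤ y 1 * y 2 ^ 2 := by
      have h2 : (1 / 2) ^ 2 ≤ y 2 ^ 2 := pow_le_pow_left₀ (by norm_num) hy2 2
      linarith [mul_le_mul hy1 h2 (by norm_num) (by linarith)]
    rw [hexp, e]
    have : 0 ≤ |(a : ℝ)| * |(b : ℝ)| * K ^ 2 / 8 := by positivity
    linarith [mul_le_mul_of_nonneg_right hy3 this]

-- Passage to the limit

theorem ModularCurve.mk_mem_closure {S : Set ModularCurve} {w : ℕ → ℂ} {z : ℍ}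
    (hw : Tendsto w atTop (𝓝 (z : ℂ)))
    (h : ∀ᶠ t in atTop, ∃ x : ℍ, (x : ℂ) = w t ∧ ModularCurve.mk x ∈ S) :
    ModularCurve.mk z ∈ closure S := by
  have hz : z ∈ closure (ModularCurve.mk ⁻¹' S) := by
    rw [UpperHalfPlane.isEmbedding_coe.isInducing.closure_eq_preimage_closure_image]
    refine mem_closure_of_tendsto hw (h.mono ?_)
    rintro t ⟨x, hx, hxS⟩
    exact ⟨x, hxS, hx⟩
  exact map_mem_closure (continuous_quotient_mk' : Continuous ModularCurve.mk) hz fun x hx => hx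

theorem tendsto_div_of_abs_sub_le {x y k : ℕ → ℝ} {L C : ℝ} (hk : Tendsto k atTop atTop)
    (h : ∀ᶠ t in atTop, |x t - y t| ≤ C) (hy : Tendsto (fun t => y t / k t) atTop (𝓝 L)) :
    Tendsto (fun t => x t / k t) atTop (𝓝 L) := by
  have h0 : Tendsto (fun t => (x t - y t) / k t) atTop (𝓝 0) := by
    refine squeeze_zero_norm' ?_ (hk.const_div_atTop C)
    filter_upwards [h, hk.eventually_gt_atTop 0] with t ht hpos
    rw [norm_div, Real.norm_eq_abs, Real.norm_eq_abs, abs_of_pos hpos]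
    gcongr
  have := h0.add hy
  rw [zero_add] at this
  refine this.congr fun t => ?_
  ring

theorem tendsto_exp_div {A k : ℕ → ℝ} {L : ℝ} (hk : Tendsto k atTop atTop)
    (hA : Tendsto (fun t => A t / k t) atTop (𝓝 L)) (hL : L < 1) :
    Tendsto (fun t => Real.exp (A t) / Real.exp (k t)) atTop (𝓝 0) := by
  have h1 : Tendsto (fun t => k t * (A t / k t - 1)) atTop atBot :=
    hk.atTop_mul_neg (by linarith : L - 1 < 0) (hA.sub_const 1)
  refine (Real.tendsto_exp_atBot.comp h1).congr' ?_
  filter_upwards [hk.eventually_gt_atTop 0] with t ht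
  rw [Function.comp_apply, ← Real.exp_sub]
  congr 1
  field_simp

theorem tendsto_inv_smul_euclidean {k : ℕ → ℝ} {W : ℕ → EuclideanSpace ℝ (Fin 3)} {x y z : ℝ}
    (h0 : Tendsto (fun t => W t 0 / k t) atTop (𝓝 x))
    (h1 : Tendsto (fun t => W t 1 / k t) atTop (𝓝 y))
    (h2 : Tendsto (fun t => W t 2 / k t) atTop (𝓝 z)) :
    Tendsto (fun t => (k t)⁻¹ • W t) atTop (𝓝 !₂[x, y, z]) := by
  have h : Tendsto (fun t i => W t i / k t) atTop (𝓝 ![x, y, z]) := by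
    rw [tendsto_pi_nhds]
    intro i
    fin_cases i
    exacts [h0, h1, h2]
  refine (((PiLp.continuous_toLp 2 _).tendsto _).comp h).congr fun t => ?_
  ext i
  simp [div_eq_inv_mul]

theorem eventually_norm_sq_le {k : ℕ → ℝ} {W : ℕ → EuclideanSpace ℝ (Fin 3)}
    {w : EuclideanSpace ℝ (Fin 3)} {M : ℝ} (hk : Tendsto k atTop atTop)
    (hW : Tendsto (fun t => (k t)⁻¹ • W t) atTop (𝓝 w)) (hM : ‖w‖ ^ 2 < 3 * M) :
    ∀ᶠ t in atTop, ‖W t‖ ^ 2 ≤ 3 * (M * k t ^ 2) := by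
  filter_upwards [(hW.norm.pow 2).eventually_lt_const hM, hk.eventually_gt_atTop 0] with t ht hpos
  rw [norm_smul, mul_pow, norm_inv, Real.norm_eq_abs, inv_pow, sq_abs, inv_mul_lt_iff₀
    (by positivity)] at ht
  linarith

/-- The inequalities between the limits are strict, so an intermediate `M` leaves room on both sides
and they persist for all large `t`. -/
theorem exists_between_of_shape {A B : ℝ} (hA : 0 ≤ A) (hAB : A ≤ B) (hA3 : 3 * A ≤ 1)
    (hB : B ≤ 1) : ∃ M, 0 ≤ M ∧ M < (2 + A + B) ^ 2 / 2 ∧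
      ‖!₂[-(B + 1), B - A, A + 1]‖ ^ 2 < 3 * M ∧
      ‖!₂[B, -(B + 2 * A + 1), 2 * A + 1]‖ ^ 2 < 3 * M ∧
      (‖!₂[-(B + 1), B - A, A + 1] - !₂[B, -(B + 2 * A + 1), 2 * A + 1]‖ ^ 2 < 3 * M ∨
        ‖!₂[-(B + 1), B - A, A + 1] + !₂[B, -(B + 2 * A + 1), 2 * A + 1]‖ ^ 2 < 3 * M) := by
  obtain ⟨h1, h2, h3⟩ := shape_inequalities hA hAB hA3 hB
  simp only [EuclideanSpace.real_norm_sq_eq, Fin.sum_univ_three, PiLp.sub_apply, PiLp.add_apply,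
    Matrix.cons_val]
  obtain ⟨M, hM, hM'⟩ : ∃ M, M < (2 + A + B) ^ 2 / 2 ∧
      max (max ((-1 - B) ^ 2 + (B - A) ^ 2 + (1 + A) ^ 2)
        (B ^ 2 + (-(1 + B + 2 * A)) ^ 2 + (1 + 2 * A) ^ 2))
      (min ((-1 - B - B) ^ 2 + (B - A - -(1 + B + 2 * A)) ^ 2 + (1 + A - (1 + 2 * A)) ^ 2)
        ((-1 - B + B) ^ 2 + (B - A + -(1 + B + 2 * A)) ^ 2 + (1 + A + (1 + 2 * A)) ^ 2))
        < 3 * M := by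
    obtain ⟨N, hN, hN'⟩ := exists_between (max_lt (max_lt h1 h2) (min_lt_iff.2 h3))
    exact ⟨N / 3, by linarith, by linarith⟩
  simp only [max_lt_iff, min_lt_iff] at hM'
  obtain ⟨⟨e1, e2⟩, e3⟩ := hM'
  refine ⟨M, ?_, hM, by linarith, by linarith, e3.imp (fun h => ?_) (fun h => ?_)⟩
  · nlinarith [sq_nonneg (-1 - B), sq_nonneg (B - A), sq_nonneg (1 + A)]
  · linarith
  · linarith

theorem hexMap_div_hexMap_eq_shapeCurve (α β r : ℝ) :
    hexMap !₂[r * β, -(r * β + 2 * (r * α) + 1), 2 * (r * α) + 1]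
      / hexMap !₂[-(r * β + 1), r * β - r * α, r * α + 1] = shapeCurve α β r := by
  rw [shapeCurve, hexMap_apply, hexMap_apply]
  simp only [Matrix.cons_val]
  push_cast
  congr 1 <;> ring

/-- The theorem for parameters in the interior of the interval and pairs of nonzero integers. -/
theorem mk_mem_closure_of_ne_zero {a b : ℕ → ℤ} {α β r : ℝ} (hab : IsMutuallyCubicRootSequence a b)
    (ha : Tendsto (fun t : ℕ => Real.log |(a t : ℝ)| / Real.log |(t : ℝ)|) atTop (𝓝 α))
    (hb : Tendsto (fun t : ℕ => Real.log |(b t : ℝ)| / Real.log |(t : ℝ)|) atTop (𝓝 β))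
    (hα : 0 ≤ α) (hαβ : α ≤ β) (ha0 : ∀ t, a t ≠ 0) (hb0 : ∀ t, b t ≠ 0) (hr : 0 < r)
    (hαr : 3 * α * r < 1) (hβr : β * r < 1) {z : ℍ} (hz : (z : ℂ) = shapeCurve α β r) :
    ModularCurve.mk z ∈ closure unitShapes := by
  -- This is `log K` for `K = t^(1/r)`, so that dividing by `k` instead of `log t` multiplies limits
  -- by `r`.
  set k : ℕ → ℝ := fun t => Real.log t / r with hkdef
  have hk : Tendsto k atTop atTop :=
    (Real.tendsto_log_atTop.comp tendsto_natCast_atTop_atTop).atTop_div_const hr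
  have hscale : ∀ {x : ℕ → ℝ} {L : ℝ},
      Tendsto (fun t : ℕ => x t / Real.log |(t : ℝ)|) atTop (𝓝 L) →
      Tendsto (fun t => x t / k t) atTop (𝓝 (r * L)) := fun {x L} h => by
    refine (h.const_mul r).congr fun t => ?_
    rw [Real.log_abs, hkdef, div_div_eq_mul_div]
    ring
  have hA := hscale ha
  have hB := hscale hb
  have hkk : Tendsto (fun t => k t / k t) atTop (𝓝 1) := by
    refine tendsto_const_nhds.congr' ?_
    filter_upwards [hk.eventually_gt_atTop 0] with t ht
    rw [div_self ht.ne']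
  have hrα : 0 ≤ r * α := mul_nonneg hr.le hα
  have hrαβ : r * α ≤ r * β := mul_le_mul_of_nonneg_left hαβ hr.le
  obtain ⟨M, hM0, hM, hMU, hMV, hMUV⟩ := exists_between_of_shape hrα hrαβ (by linarith)
    (by linarith)
  -- Since `rα < 1` and `rβ < 1`, both `|a|` and `|b|` are negligible against `K`.
  have hlarge : ∀ᶠ t in atTop, 100 * (2 + |(a t : ℝ)| + |(b t : ℝ)|) ≤ Real.exp (k t) := by
    have e1 := tendsto_exp_div hk hA (by linarith)
    have e2 := tendsto_exp_div hk hB (by linarith)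
    have e3 := Real.tendsto_exp_atTop.comp hk
    filter_upwards [e1.eventually_lt_const (by norm_num : (0 : ℝ) < 1 / 400),
      e2.eventually_lt_const (by norm_num : (0 : ℝ) < 1 / 400),
      e3.eventually_ge_atTop 400] with t h1 h2 h3
    rw [div_lt_iff₀ (Real.exp_pos _), Real.exp_log (by simpa using ha0 t)] at h1
    rw [div_lt_iff₀ (Real.exp_pos _), Real.exp_log (by simpa using hb0 t)] at h2
    rw [Function.comp_apply] at h3
    linarith
  have hex := hlarge.mono fun t ht =>
    (hab t).exists_unitShape (ha0 t) (hb0 t) ht rfl rfl (Real.log_exp (k t)).symm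
  obtain ⟨U, hex⟩ := hex.choice
  obtain ⟨V, hex⟩ := hex.choice
  have lim : ∀ {x y : ℕ → ℝ} {L : ℝ}, (∀ᶠ t in atTop, |x t - y t| ≤ 2 * Real.log 4) →
      Tendsto (fun t => y t / k t) atTop (𝓝 L) → Tendsto (fun t => x t / k t) atTop (𝓝 L) :=
    fun h hy => tendsto_div_of_abs_sub_le hk h hy
  have hU : Tendsto (fun t => (k t)⁻¹ • U t) atTop
      (𝓝 !₂[-(r * β + 1), r * β - r * α, r * α + 1]) := by
    refine tendsto_inv_smul_euclidean (lim (hex.mono fun t h => h.1) ?_)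
      (lim (hex.mono fun t h => h.2.1) ?_) (lim (hex.mono fun t h => h.2.2.1) ?_)
    · exact (hB.add hkk).neg.congr fun t => by ring
    · exact (hB.sub hA).congr fun t => by ring
    · exact (hA.add hkk).congr fun t => by ring
  have hV : Tendsto (fun t => (k t)⁻¹ • V t) atTop
      (𝓝 !₂[r * β, -(r * β + 2 * (r * α) + 1), 2 * (r * α) + 1]) := by
    refine tendsto_inv_smul_euclidean (lim (hex.mono fun t h => h.2.2.2.1) hB)
      (lim (hex.mono fun t h => h.2.2.2.2.1) ?_) (lim (hex.mono fun t h => h.2.2.2.2.2.1) ?_)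
    · exact ((hB.add (hA.const_mul 2)).add hkk).neg.congr fun t => by ring
    · exact ((hA.const_mul 2).add hkk).congr fun t => by ring
  have hl : Tendsto (fun t => (Real.log |(a t : ℝ)| + Real.log |(b t : ℝ)| + 2 * k t
      - Real.log 512) / k t) atTop (𝓝 (2 + r * α + r * β)) := by
    refine tendsto_div_of_abs_sub_le (C := Real.log 512)
      (y := fun t => Real.log |(a t : ℝ)| + Real.log |(b t : ℝ)| + 2 * k t) hk
      (.of_forall fun t => ?_) ?_
    · rw [sub_sub_cancel_left, abs_neg, abs_of_nonneg (Real.log_nonneg (by norm_num))]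
    · have := (hA.add hB).add (hkk.const_mul 2)
      rw [show r * α + r * β + 2 * 1 = 2 + r * α + r * β by ring] at this
      exact this.congr fun t => by ring
  have hcont : Continuous hexMap := hexMap.continuous_of_finiteDimensional
  have hzne : hexMap !₂[-(r * β + 1), r * β - r * α, r * α + 1] ≠ 0 := fun h => z.ne_zero (by
    rw [hz, ← hexMap_div_hexMap_eq_shapeCurve, h, div_zero])
  have hw : Tendsto (fun t => hexMap (V t) / hexMap (U t)) atTop (𝓝 (z : ℂ)) := by
    rw [hz, ← hexMap_div_hexMap_eq_shapeCurve]
    refine (((hcont.tendsto _).comp hV).div ((hcont.tendsto _).comp hU) hzne).congr' ?_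
    filter_upwards [hk.eventually_gt_atTop 0] with t ht
    simp only [Pi.div_apply, Function.comp_apply, map_smul, Complex.real_smul]
    exact mul_div_mul_left _ _ (by simpa using ht.ne')
  refine ModularCurve.mk_mem_closure hw ?_
  have him : ∀ᶠ t in atTop, 0 < (hexMap (V t) / hexMap (U t)).im :=
    ((Complex.continuous_im.tendsto _).comp hw).eventually_const_lt z.im_pos
  have huv : ∀ᶠ t in atTop, ‖U t - V t‖ ^ 2 ≤ 3 * (M * k t ^ 2) ∨
      ‖U t + V t‖ ^ 2 ≤ 3 * (M * k t ^ 2) := by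
    rcases hMUV with h | h
    · have := (hU.sub hV).congr fun t => (smul_sub _ _ _).symm
      exact (eventually_norm_sq_le hk this h).mono fun t => .inl
    · have := (hU.add hV).congr fun t => (smul_add _ _ _).symm
      exact (eventually_norm_sq_le hk this h).mono fun t => .inr
  filter_upwards [hex, him, huv, eventually_norm_sq_le hk hU hMU, eventually_norm_sq_le hk hV hMV,
    hk.eventually_gt_atTop 0, hl.eventually_const_lt (by linarith : 0 < 2 + r * α + r * β),
    ((hl.pow 2).div_const 2).eventually_const_lt hM] with t h1 h2 h3 h4 h5 h6 h7 h8
  refine ⟨⟨_, h2⟩, rfl, h1.2.2.2.2.2.2 (M * k t ^ 2) ?_ ?_ h4 h5 h3 _ rfl⟩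
  · exact ((div_pos_iff_of_pos_right h6).1 h7).le
  · rw [div_pow, div_right_comm, lt_div_iff₀ (by positivity)] at h8
    exact h8

theorem IsMutuallyCubicRootPair.eq_one_of_eq_zero {a b : ℤ} (h : IsMutuallyCubicRootPair a b) :
    (a = 0 → b = 1) ∧ (b = 0 → a = 1) := by
  have key : ∀ x : ℤ, x ^ 3 ≡ 1 [ZMOD 0] → x = 1 := fun x hx => by
    rw [Int.modEq_zero_iff] at hx
    exact (Odd.strictMono_pow (by decide : Odd 3)).injective (by simpa using hx)
  exact ⟨fun h0 => key b (h0 ▸ h.2), fun h0 => key a (h0 ▸ h.1)⟩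

theorem mk_mem_closure_of_mem_interior {a b : ℕ → ℤ} {α β r : ℝ}
    (hab : IsMutuallyCubicRootSequence a b)
    (ha : Tendsto (fun t : ℕ => Real.log |(a t : ℝ)| / Real.log |(t : ℝ)|) atTop (𝓝 α))
    (hb : Tendsto (fun t : ℕ => Real.log |(b t : ℝ)| / Real.log |(t : ℝ)|) atTop (𝓝 β))
    (hα : 0 ≤ α) (hαβ : α ≤ β) (hr : 0 < r)
    (hαr : 3 * α * r < 1) (hβr : β * r < 1) {z : ℍ} (hz : (z : ℂ) = shapeCurve α β r) :
    ModularCurve.mk z ∈ closure unitShapes := by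
  -- If one entry is 0 the other is 1, so replacing 0 by 1 gives the pair `(1, 1)`. The limits do
  -- not change, as `Real.log 0 = 0 = Real.log 1`.
  refine mk_mem_closure_of_ne_zero (a := fun t => if a t = 0 then 1 else a t)
    (b := fun t => if b t = 0 then 1 else b t) (fun t => ?_) (ha.congr fun t => ?_)
    (hb.congr fun t => ?_) hα hαβ (fun t => ?_) (fun t => ?_) hr hαr hβr hz
  · obtain ⟨h1, h2⟩ := (hab t).eq_one_of_eq_zero
    by_cases h3 : a t = 0
    · simp [h3, h1 h3, IsMutuallyCubicRootPair, Int.ModEq.refl]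
    by_cases h4 : b t = 0
    · simp [h4, h2 h4, IsMutuallyCubicRootPair, Int.ModEq.refl]
    simpa [h3, h4] using hab t
  all_goals split_ifs with h <;> simp [h]

theorem continuousOn_shapeCurve {α β : ℝ} (hα : 0 ≤ α) (hβ : 0 ≤ β) :
    ContinuousOn (shapeCurve α β) (Set.Ici 0) := by
  unfold shapeCurve
  refine ContinuousOn.div (by fun_prop) (by fun_prop) fun r hr h => ?_
  have := shapeCurve_im_pos hα hβ hr
  rw [shapeCurve, h, div_zero] at this
  exact this.ne' rfl

theorem theorem1p4 (a b : ℕ → ℤ) (α β : ℝ) (hab : IsMutuallyCubicRootSequence a b)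
    (ha : Tendsto (fun t : ℕ => Real.log |(a t : ℝ)| / Real.log |(t : ℝ)|) atTop (𝓝 α))
    (hb : Tendsto (fun t : ℕ => Real.log |(b t : ℝ)| / Real.log |(t : ℝ)|) atTop (𝓝 β))
    (hα : 0 ≤ α) (hαβ : α ≤ β) :
    ∀ r ∈ curveDomain α β, ∃ z : ℍ, (z : ℂ) = shapeCurve α β r ∧
      ModularCurve.mk z ∈ closure unitShapes := by
  rintro r ⟨hr, hαr, hβr⟩
  have hβ : 0 ≤ β := hα.trans hαβ
  refine ⟨⟨_, shapeCurve_im_pos hα hβ hr⟩, rfl, ?_⟩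
  rw [← closure_closure]
  -- A point strictly inside the interval. The convex combinations `ρ n` of `r` and `s` are interior
  -- and tend to `r`, which covers both endpoints, including `r = 0`.
  set s : ℝ := 1 / (3 * α + β + 1) with hs
  have hs0 : 0 < s := by positivity
  have hs1 : (3 * α + β + 1) * s = 1 := by rw [hs]; field_simp
  set e : ℕ → ℝ := fun n => 1 / ((n : ℝ) + 1) with he
  have he0 : ∀ n, 0 < e n := fun n => by positivity
  have he1 : ∀ n, e n ≤ 1 := fun n => by
    rw [he]
    exact div_le_one_of_le₀ (by simp) (by positivity)
  have hlim : Tendsto e atTop (𝓝 0) := tendsto_one_div_add_atTop_nhds_zero_nat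
  set ρ : ℕ → ℝ := fun n => (1 - e n) * r + e n * s with hρ
  have hρ0 : ∀ n, 0 < ρ n := fun n =>
    add_pos_of_nonneg_of_pos (mul_nonneg (sub_nonneg.2 (he1 n)) hr) (mul_pos (he0 n) hs0)
  have hρlim : Tendsto ρ atTop (𝓝 r) := by
    have := ((hlim.const_sub 1).mul_const r).add (hlim.mul_const s)
    simpa using this
  have hlt : ∀ c, c * r ≤ 1 → c * s < 1 → ∀ n, c * ρ n < 1 := fun c h1 h2 n => by
    have e1 := mul_le_mul_of_nonneg_left h1 (sub_nonneg.2 (he1 n))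
    have e2 := mul_lt_mul_of_pos_left h2 (he0 n)
    calc c * ρ n = (1 - e n) * (c * r) + e n * (c * s) := by rw [hρ]; ring
      _ < 1 := by linarith
  have hα3 : 0 ≤ α * s := by positivity
  have hβs : 0 ≤ β * s := by positivity
  refine ModularCurve.mk_mem_closure (w := fun n => shapeCurve α β (ρ n)) ?_
    (.of_forall fun n => ⟨⟨_, shapeCurve_im_pos hα hβ (hρ0 n).le⟩, rfl, ?_⟩)
  · exact ((continuousOn_shapeCurve hα hβ) r hr).tendsto.comp
      (tendsto_nhdsWithin_iff.2 ⟨hρlim, .of_forall fun n => (hρ0 n).le⟩)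
  · exact mk_mem_closure_of_mem_interior hab ha hb hα hαβ (hρ0 n) (hlt _ hαr (by linarith) n)
      (hlt _ hβr (by linarith) n) rfl
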